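/- **Setting.** Let $(\mathcal S,\mathcal A,\mathcal P,c,\gamma)$ be a discounted Markov decision process with finite non-empty state and action spaces and $\gamma\in[0,1)$, and for each $s\in\mathcal S$ let $h^{\cdot}(s):\Delta_{|\mathcal A|}\to\mathbb R$ be a closed convex regularizer on the probability simplex. For a policy $\pi$, with $a_t\sim\pi(\cdot|s_t)$ and $s_{t+1}\sim\mathcal P(\cdot|s_t,a_t)$, put $$Q^\pi(s,a)=\mathbb E\Big[\sum_{t\ge 0}\gamma^t\big(c(s_t,a_t)+h^{\pi(\cdot|s_t)}(s_t)\big)\,\Big|\,s_0=s,a_0=a\Big],\qquad V^\pi(s)=\mathbb E\Big[\sum_{t\ge 0}\gamma^t\big(c(s_t,a_t)+h^{\pi(\cdot|s_t)}(s_t)\big)\,\Big|\,s_0=s\Big].$$ Let $\pi^*$ be an optimal policy, i.e. $V^{\pi^*}(s)\le V^\pi(s)$ for all $\pi,s$, and let $\hat\pi$ be any fixed policy. Let $\|\cdot\|$ be a norm on $\mathbb R^{\mathcal A}$ with dual norm $\|\cdot\|_*$; for $q:\mathcal S\times\mathcal A\to\mathbb R$ write $\|q\|_*=\max_s\|q(s,\cdot)\|_*$.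 Let $\omega:\Delta_{|\mathcal A|}\to\mathbb R$ be continuous and $1$-strongly convex with respect to $\|\cdot\|$, with Bregman distance $D(q,p)=\omega(p)-\omega(q)-\langle\nabla\omega(q),p-q\rangle$. Let $\pi_0$ be a policy such that $\omega$ is differentiable (within the simplex) at every $\pi_0(\cdot|s)$, and let $\bar D_0>0$ satisfy $D(\pi_0(\cdot|s),p)\le\bar D_0$ for all $s\in\mathcal S$, $p\in\Delta_{|\mathcal A|}$. Let $N\ge 1$, let $\xi_0,\dots,\xi_{N-1}$ be random samples (not necessarily independent), and let $\tilde Q_t:\mathcal S\times\mathcal A\to\mathbb R$ be an estimate of $Q^{\hat\pi}$ formed (measurably) from $\xi_t$. Let $\mathbb E_{t-1}$ denote conditional expectation given $\xi_0,\dots,\xi_{t-1}$. Consider the following two assumptions on constants $\varsigma,\sigma,\bar Q\ge 0$; the conditional bounds hold almost surely for $0\le t<N$. * (A1) $\max_{p\in\Delta_{|\mathcal A|}}\|p\|\le 1$, $\ \|\mathbb E_{t-1}[\tilde Q_t]-Q^{\hat\pi}\|_*\le\varsigma$, $\ \mathbb E_{t-1}\|\tilde Q_t-Q^{\hat\pi}\|_*^2\le\sigma^2$,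 $\ \mathbb E_{t-1}\|\tilde Q_t\|_*^2\le\bar Q^2$. * (A2) $\max_{p\in\Delta_{|\mathcal A|}}\|p\|\le 1$, $\ \|\mathbb E_{t-1}[\tilde Q_t]-Q^{\hat\pi}\|_*\le\varsigma$, $\ \mathbb E_{t-1}\exp\{\|\tilde Q_t-Q^{\hat\pi}\|_*^2/\sigma^2\}\le 2$, $\ \mathbb E_{t-1}\exp\{\|\tilde Q_t\|_*^2/\bar Q^2\}\le 2$, where for a zero denominator the condition means that the numerator vanishes almost surely. Define $$\tilde V_t(s)=\langle\tilde Q_t(s,\cdot),\hat\pi(\cdot|s)\rangle,\qquad \tilde\psi_t(s,p)=\langle\tilde Q_t(s,\cdot),p\rangle-\tilde V_t(s)+h^p(s)-h^{\hat\pi(\cdot|s)}(s),$$ $$\tilde V_N(s)=\frac1N\sum_{t=0}^{N-1}\tilde V_t(s),\qquad \tilde G_N(s)=\frac1N\max_{p\in\Delta_{|\mathcal A|}}\Big\{-\sum_{t=0}^{N-1}\tilde\psi_t(s,p)\Big\}.$$ **Statement.** There is an absolute constant $C>0$ such that, in every such setting, both of the following hold. 1. If (A1) and (A2) hold and $\varsigma\le\sigma/(2N)$,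 then for every $s\in\mathcal S$, with $[x]_+=\max\{0,x\}$, the expectation below is finite and $$\mathbb E\Big[\Big[\tilde V_N(s)-\frac{\max_{s'\in\mathcal S}\tilde G_N(s')}{1-\gamma}-V^{\pi^*}(s)\Big]_+\Big]\le\sqrt{\frac{\sigma^2+N\varsigma^2}{N}}+\frac{2\sqrt{\sigma^2\bar D_0}}{(1-\gamma)\sqrt N}+\frac{8C\sigma(\log|\mathcal S|+1)+4\sqrt{\sigma^2+N\varsigma^2}}{(1-\gamma)\sqrt N}.$$ 2. If (A2) holds and $\varsigma\le\sigma/N$, then for every $\delta\in(0,1]$ $$\Pr\Big\{\exists s\in\mathcal S:\ \tilde V_N(s)-\frac{\max_{s'\in\mathcal S}\tilde G_N(s')}{1-\gamma}-V^{\pi^*}(s)>A_N+B_N\Big\}\le\delta,$$ where $$A_N=\sigma\sqrt{\frac{3\log(4|\mathcal S|/\delta)}{N}},\qquad B_N=\frac{4\sqrt{\sigma^2\bar D_0}+4\sigma\sqrt{3\log(16|\mathcal S|/\delta)}+24\sqrt{\sigma^2\bar D_0}\,\log(32|\mathcal S|/\delta)}{(1-\gamma)\sqrt N}.$$ -/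

import Mathlib

open MeasureTheory ProbabilityTheory

universe uS uA uX uO

noncomputable section

/-! ### Regularized Markov decision processes -/

/-- A finite discounted MDP with transition probabilities `trans s a s'` (the probability of moving
to `s'` when action `a` is taken in state `s`), cost `cost`, discount factor `γ ∈ [0, 1)`, and for
every state a real-valued closed convex regularizer `reg s` on the probability simplex over the
actions (its values off the simplex are irrelevant). -/
structure RegMDP (S : Type uS) (A : Type uA) [Fintype S] [Fintype A] where
  trans : S → A → S → ℝ
  trans_nonneg : ∀ s a s', 0 ≤ trans s a s'
  trans_sum : ∀ s a, ∑ s', trans s a s' = 1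
  cost : S → A → ℝ
  γ : ℝ
  γ_nonneg : 0 ≤ γ
  γ_lt_one : γ < 1
  reg : S → (A → ℝ) → ℝ
  reg_convex : ∀ s, ConvexOn ℝ (stdSimplex ℝ A) (reg s)
  reg_closed : ∀ s, LowerSemicontinuousOn (reg s) (stdSimplex ℝ A)

/-- A (stationary, randomized) policy: for each state a probability vector over the actions. -/
abbrev Policy (S : Type uS) (A : Type uA) [Fintype A] : Type (max uS uA) :=
  S → stdSimplex ℝ A

namespace RegMDP

variable {S : Type uS} {A : Type uA} [Fintype S] [Fintype A]

section Trajectories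

variable [MeasurableSpace S] [MeasurableSingletonClass S]
  [MeasurableSpace A] [MeasurableSingletonClass A]

/-- Law of `(s_{t+1}, a_{t+1})` given `(s_t, a_t) = x`: the next state is drawn from the transition
probabilities, then the next action from the policy. -/
def stepLaw (M : RegMDP S A) (π : Policy S A) (x : S × A) : Measure (S × A) :=
  ∑ s', ∑ a', ENNReal.ofReal (M.trans x.1 x.2 s' * π s' a') • Measure.dirac (s', a')

/-- The transition kernel of the state-action chain. -/
def stepKernel (M : RegMDP S A) (π : Policy S A) : Kernel (S × A) (S × A) where
  toFun := M.stepLaw π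
  measurable' := measurable_of_countable _

instance (M : RegMDP S A) (π : Policy S A) : IsMarkovKernel (M.stepKernel π) := by
  refine ⟨fun x => ⟨?_⟩⟩
  change (M.stepLaw π x) Set.univ = 1
  have hnn : ∀ s' a', 0 ≤ M.trans x.1 x.2 s' * π s' a' := fun s' a' =>
    mul_nonneg (M.trans_nonneg _ _ _) ((π s').2.1 a')
  simp only [stepLaw, Measure.coe_finsetSum, Finset.sum_apply, Measure.smul_apply,
    measure_univ, smul_eq_mul, mul_one]
  simp_rw [← ENNReal.ofReal_sum_of_nonneg (fun a' _ => hnn _ a')]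
  rw [← ENNReal.ofReal_sum_of_nonneg (fun s' _ => Finset.sum_nonneg fun a' _ => hnn s' a')]
  have h1 : ∀ s', ∑ a', π s' a' = 1 := fun s' => (π s').2.2
  simp_rw [← Finset.mul_sum, h1, mul_one, M.trans_sum]
  simp

/-- The chain as a history-dependent kernel: only the last state-action pair is used. -/
def historyKernel (M : RegMDP S A) (π : Policy S A) (n : ℕ) :
    Kernel ((i : Finset.Iic n) → S × A) (S × A) :=
  (M.stepKernel π).comap (fun x => x ⟨n, Finset.mem_Iic.2 le_rfl⟩) (measurable_pi_apply _)

instance (M : RegMDP S A) (π : Policy S A) (n : ℕ) : IsMarkovKernel (M.historyKernel π n) := by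
  unfold historyKernel; infer_instance

/-- Law of `(s_0, a_0)` given `s_0 = s`, with `a_0` drawn from the policy. -/
def startLaw (π : Policy S A) (s : S) : Measure (S × A) :=
  ∑ a, ENNReal.ofReal (π s a) • Measure.dirac (s, a)

instance (π : Policy S A) (s : S) : IsProbabilityMeasure (startLaw π s) := by
  refine ⟨?_⟩
  simp only [startLaw, Measure.coe_finsetSum, Finset.sum_apply, Measure.smul_apply,
    measure_univ, smul_eq_mul, mul_one]
  have h1 : ∑ a, π s a = 1 := (π s).2.2
  have h0 : ∀ a, 0 ≤ π s a := (π s).2.1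
  rw [← ENNReal.ofReal_sum_of_nonneg (fun a _ => h0 a), h1]
  simp

/-- Law of the trajectory `(s_0, a_0), (s_1, a_1), …` under the policy `π`, where `(s_0, a_0)` has
law `μ₀`. -/
def trajectoryLaw (M : RegMDP S A) (π : Policy S A) (μ₀ : Measure (S × A))
    [IsProbabilityMeasure μ₀] : Measure (ℕ → S × A) :=
  Kernel.trajMeasure (X := fun _ => S × A) μ₀ (M.historyKernel π)

/-- The discounted regularized cost `∑_t γ^t (c(s_t, a_t) + h^{π(·|s_t)}(s_t))` of a trajectory. -/
def discountedCost (M : RegMDP S A) (π : Policy S A) (x : ℕ → S × A) : ℝ :=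
  ∑' t, M.γ ^ t * (M.cost (x t).1 (x t).2 + M.reg (x t).1 (π (x t).1))

/-- The action-value function `Q^π(s, a)`. -/
def Q (M : RegMDP S A) (π : Policy S A) (s : S) (a : A) : ℝ :=
  ∫ x, M.discountedCost π x ∂(M.trajectoryLaw π (Measure.dirac (s, a)))

/-- The state-value function `V^π(s)`. -/
def V (M : RegMDP S A) (π : Policy S A) (s : S) : ℝ :=
  ∫ x, M.discountedCost π x ∂(M.trajectoryLaw π (startLaw π s))

/-- `π` minimizes the value function at every state, among all policies. -/
def IsOptimal (M : RegMDP S A) (π : Policy S A) : Prop :=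
  ∀ (π' : Policy S A) (s : S), M.V π s ≤ M.V π' s

end Trajectories

/-! ### Offline estimates

Below `q t : S → A → ℝ` is the `t`-th estimate of the action-value function of the policy `π`. -/

/-- The value estimate `Ṽ(s) = ⟨q(s, ·), π(· | s)⟩`. -/
def noisyValue (π : Policy S A) (q : S → A → ℝ) (s : S) : ℝ :=
  ∑ a, q s a * π s a

/-- The advantage estimate `⟨q(s, ·), p⟩ - Ṽ(s) + h^p(s) - h^{π(·|s)}(s)`. -/
def noisyAdvantage (M : RegMDP S A) (π : Policy S A) (q : S → A → ℝ) (s : S) (p : A → ℝ) : ℝ :=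
  ∑ a, q s a * p a - noisyValue π q s + M.reg s p - M.reg s (π s)

/-- The averaged value estimate `Ṽ_N(s)`. -/
def offlineValue (π : Policy S A) (N : ℕ) (q : ℕ → S → A → ℝ) (s : S) : ℝ :=
  (N : ℝ)⁻¹ * ∑ t ∈ Finset.range N, noisyValue π (q t) s

/-- The estimated advantage gap `G̃_N(s)`. -/
def offlineGap (M : RegMDP S A) (π : Policy S A) (N : ℕ) (q : ℕ → S → A → ℝ) (s : S) : ℝ :=
  (N : ℝ)⁻¹ * ⨆ p : stdSimplex ℝ A, -∑ t ∈ Finset.range N, M.noisyAdvantage π (q t) s p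

/-- The offline estimate `Ṽ_N(s) - (1 - γ)⁻¹ max_{s'} G̃_N(s')` of the optimal value. -/
def offlineEstimate (M : RegMDP S A) (π : Policy S A) (N : ℕ) (q : ℕ → S → A → ℝ) (s : S) : ℝ :=
  offlineValue π N q s - (1 - M.γ)⁻¹ * ⨆ s' : S, M.offlineGap π N q s'

end RegMDP

/-! ### Norms and Bregman distances -/

section Norms

variable {S : Type uS} {A : Type uA} [Fintype S] [Fintype A]

/-- The dual norm of `ν` on `ℝ^A`. -/
def dualNorm (ν : Seminorm ℝ (A → ℝ)) (y : A → ℝ) : ℝ :=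
  sSup ((fun x : A → ℝ => ∑ a, y a * x a) '' {x | ν x ≤ 1})

/-- The dual norm of a state-action function: the largest dual norm over the states. -/
def maxDualNorm (ν : Seminorm ℝ (A → ℝ)) (q : S → A → ℝ) : ℝ :=
  ⨆ s, dualNorm ν (q s)

/-- Bregman's distance `ω(p) - ω(q) - ⟨∇ω(q), p - q⟩` on the simplex. The derivative is taken within
the simplex, so only the values of `ω` on the simplex matter. -/
def bregman (ω : (A → ℝ) → ℝ) (q p : A → ℝ) : ℝ :=
  ω p - ω q - fderivWithin ℝ ω (stdSimplex ℝ A) q (p - q)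

/-- `ω` is a distance generating function on the simplex for the norm `ν`: it is continuous and
`1`-strongly convex with respect to `ν`. -/
structure IsDistanceGenerating (ν : Seminorm ℝ (A → ℝ)) (ω : (A → ℝ) → ℝ) : Prop where
  continuousOn : ContinuousOn ω (stdSimplex ℝ A)
  strongConvex : ∀ p ∈ stdSimplex ℝ A, ∀ q ∈ stdSimplex ℝ A, ∀ a b : ℝ, 0 ≤ a → 0 ≤ b → a + b = 1 →
    ω (a • p + b • q) ≤ a * ω p + b * ω q - a * b / 2 * ν (p - q) ^ 2

end Norms

/-! ### Assumptions on the noise -/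

section Noise

/-- The σ-algebra generated by `ξ_0, …, ξ_{t-1}`. -/
@[reducible]
def pastSigma {Ω : Type uO} {X : Type uX} [mX : MeasurableSpace X] (ξ : ℕ → Ω → X) (t : ℕ) :
    MeasurableSpace Ω :=
  ⨆ (i : ℕ) (_ : i < t), MeasurableSpace.comap (ξ i) mX

variable {Ω : Type uO}

/-- `f` is integrable, with conditional expectation given `m` at most `c` almost surely. -/
def CondExpLE (m : MeasurableSpace Ω) {mΩ : MeasurableSpace Ω} (μ : Measure Ω)
    (f : Ω → ℝ) (c : ℝ) : Prop :=
  Integrable f μ ∧ ∀ᵐ ω ∂μ, (μ[f | m]) ω ≤ c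

/-- `E[exp(f² / c²) | m] ≤ 2` almost surely. For `c = 0` the quotient is read as `+∞` where
`f ≠ 0`, so that the condition then says that `f = 0` almost surely. -/
def CondSubgaussian (m : MeasurableSpace Ω) {mΩ : MeasurableSpace Ω} (μ : Measure Ω)
    (f : Ω → ℝ) (c : ℝ) : Prop :=
  CondExpLE m μ (fun ω => Real.exp (f ω ^ 2 / c ^ 2)) 2 ∧ (c = 0 → ∀ᵐ ω ∂μ, f ω = 0)

variable {S : Type uS} {A : Type uA} [Fintype S] [Fintype A]

/-- The dual norm of the conditional bias of the estimates `Qt 0, …, Qt (N-1)` of `Q`, given the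
past `F`, is at most `ς` almost surely. -/
def BiasBound {mΩ : MeasurableSpace Ω} (μ : Measure Ω)
    (F : ℕ → MeasurableSpace Ω) (N : ℕ)
    (ν : Seminorm ℝ (A → ℝ))
    (Q : S → A → ℝ) (Qt : ℕ → Ω → S → A → ℝ) (ς : ℝ) : Prop :=
  ∀ t < N, (∀ s a, Integrable (fun ω => Qt t ω s a) μ) ∧
    ∀ᵐ ω ∂μ, maxDualNorm ν (fun s a => (μ[fun ω' => Qt t ω' s a | F t]) ω - Q s a) ≤ ς

/-- Bounds on the conditional bias, variance and second moment of the estimates. -/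
structure MomentAssumption {mΩ : MeasurableSpace Ω} (μ : Measure Ω)
    (F : ℕ → MeasurableSpace Ω) (N : ℕ)
    (ν : Seminorm ℝ (A → ℝ)) (Q : S → A → ℝ) (Qt : ℕ → Ω → S → A → ℝ) (ς σ Qbar : ℝ) : Prop where
  norm_le_one : ∀ p ∈ stdSimplex ℝ A, ν p ≤ 1
  bias : BiasBound μ F N ν Q Qt ς
  variance : ∀ t < N,
    CondExpLE (F t) μ (fun ω => maxDualNorm ν (fun s a => Qt t ω s a - Q s a) ^ 2) (σ ^ 2)
  second_moment : ∀ t < N, CondExpLE (F t) μ (fun ω => maxDualNorm ν (Qt t ω) ^ 2) (Qbar ^ 2)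

/-- Bounds on the conditional bias and on the conditional exponential moments of the estimates. -/
structure LightTailAssumption {mΩ : MeasurableSpace Ω} (μ : Measure Ω)
    (F : ℕ → MeasurableSpace Ω) (N : ℕ)
    (ν : Seminorm ℝ (A → ℝ)) (Q : S → A → ℝ) (Qt : ℕ → Ω → S → A → ℝ) (ς σ Qbar : ℝ) : Prop where
  norm_le_one : ∀ p ∈ stdSimplex ℝ A, ν p ≤ 1
  bias : BiasBound μ F N ν Q Qt ς
  noise_tail : ∀ t < N,
    CondSubgaussian (F t) μ (fun ω => maxDualNorm ν (fun s a => Qt t ω s a - Q s a)) σ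
  estimate_tail : ∀ t < N, CondSubgaussian (F t) μ (fun ω => maxDualNorm ν (Qt t ω)) Qbar

end Noise

end

/-! Write `π` for the evaluated policy and `π'` for the optimal one. The supremum in the gap
estimate is bounded below by its value at the single point `π'(·|s)`, so noise enters only through
its pairing with fixed directions; no uniform control over the simplex is needed.

By the performance difference argument (`RegMDP.V_sub_le`), `V^π - V^{π'}` is at most `(1 - γ)⁻¹`
times the largest true advantage gap of `π'`. At each state this gap is the empirical one, which is
below `G̃_N`, plus the average of `⟨Q̃_t - Q, π' - π⟩`. The value estimate differs from `V^π` by the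
average of `⟨Q̃_t - Q, π⟩`. Hence the excess of the offline estimate over `V^{π'}` is at most one
error average in direction `π(·|s)` plus `2 / (1 - γ)` times one in direction `(π' - π)/2` at some
state (`RegMDP.exists_offlineEstimate_sub_le`).

Both directions lie in the unit ball, so duality turns the assumption on the estimates into a scalar
one: adapted variables with conditional mean at most `ς` and conditional light tails at scale `σ`. A
conditional moment generating function bound, multiplied along the filtration, gives the exponential
moment of their sum. Chernoff's bound with a union bound over states yields the high probability
claim; the exponential moment at scale `σ√N`, with a soft maximum over states costing `log |S|`,
yields the bound in expectation. -/

noncomputable section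

/-! ### Value functions: from trajectories to Bellman's equation and performance difference. -/

namespace RegMDP

section Cost

lemma policy_nonneg {S : Type uS} {A : Type uA} [Fintype A] (π : Policy S A) (s : S) (a : A) : 0 ≤ π s a := (π s).2.1 a

lemma policy_sum {S : Type uS} {A : Type uA} [Fintype A] (π : Policy S A) (s : S) : ∑ a, π s a = 1 := (π s).2.2

variable {S : Type uS} {A : Type uA} [Fintype S] [Fintype A]

/-- The Markov operator of the state-action chain. -/
def stepOp (M : RegMDP S A) (π : Policy S A) (f : S × A → ℝ) (x : S × A) : ℝ :=
  ∑ s', M.trans x.1 x.2 s' * ∑ a', π s' a' * f (s', a')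

/-- The regularized cost of a single step. -/
def stepCost (M : RegMDP S A) (π : Policy S A) (x : S × A) : ℝ :=
  M.cost x.1 x.2 + M.reg x.1 (π x.1)

lemma exists_stepCost_bound (M : RegMDP S A) (π : Policy S A) :
    ∃ B, ∀ x, |M.stepCost π x| ≤ B := by
  obtain ⟨B, hB⟩ := (Set.finite_range fun x => |M.stepCost π x|).bddAbove
  exact ⟨B, fun x => hB ⟨x, rfl⟩⟩

lemma summable_discounted (M : RegMDP S A) {u : ℕ → ℝ} {B : ℝ} (hu : ∀ t, |u t| ≤ B) :
    Summable fun t => M.γ ^ t * u t := by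
  refine Summable.of_norm_bounded
    ((summable_geometric_of_lt_one M.γ_nonneg M.γ_lt_one).mul_right B) fun t => ?_
  rw [Real.norm_eq_abs, abs_mul, abs_of_nonneg (pow_nonneg M.γ_nonneg t)]
  exact mul_le_mul_of_nonneg_left (hu t) (pow_nonneg M.γ_nonneg t)

lemma abs_stepOp_le (M : RegMDP S A) (π : Policy S A) {f : S × A → ℝ} {B : ℝ}
    (hf : ∀ x, |f x| ≤ B) (x : S × A) : |M.stepOp π f x| ≤ B := by
  unfold stepOp
  have h2 : ∀ s', |∑ a', π s' a' * f (s', a')| ≤ B := fun s' =>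
    calc |∑ a', π s' a' * f (s', a')| ≤ ∑ a', |π s' a' * f (s', a')| :=
          Finset.abs_sum_le_sum_abs _ _
      _ ≤ ∑ a', π s' a' * B := Finset.sum_le_sum fun a' _ => by
          rw [abs_mul, abs_of_nonneg (policy_nonneg π s' a')]
          exact mul_le_mul_of_nonneg_left (hf _) (policy_nonneg π s' a')
      _ = B := by
          rw [← Finset.sum_mul, policy_sum, one_mul]
  calc _ ≤ ∑ s', |M.trans x.1 x.2 s' * ∑ a', π s' a' * f (s', a')| :=
        Finset.abs_sum_le_sum_abs _ _
    _ ≤ ∑ s', M.trans x.1 x.2 s' * B := Finset.sum_le_sum fun s' _ => by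
        rw [abs_mul, abs_of_nonneg (M.trans_nonneg _ _ _)]
        exact mul_le_mul_of_nonneg_left (h2 _) (M.trans_nonneg _ _ _)
    _ = B := by rw [← Finset.sum_mul, M.trans_sum, one_mul]

lemma abs_stepOp_iterate_le (M : RegMDP S A) (π : Policy S A) {f : S × A → ℝ} {B : ℝ}
    (hf : ∀ x, |f x| ≤ B) (t : ℕ) (x : S × A) : |(M.stepOp π)^[t] f x| ≤ B := by
  induction t generalizing x with
  | zero => exact hf x
  | succ t ih => rw [Function.iterate_succ_apply']; exact M.abs_stepOp_le π ih x

end Cost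

variable {S : Type uS} {A : Type uA} [Fintype S] [Fintype A]
  [MeasurableSpace S] [MeasurableSingletonClass S]
  [MeasurableSpace A] [MeasurableSingletonClass A]

lemma integral_stepKernel (M : RegMDP S A) (π : Policy S A) (f : S × A → ℝ) (x : S × A) :
    ∫ y, f y ∂(M.stepKernel π x) = M.stepOp π f x := by
  change ∫ y, f y ∂(M.stepLaw π x) = _
  have hnn : ∀ s' a', 0 ≤ M.trans x.1 x.2 s' * π s' a' := fun s' a' =>
    mul_nonneg (M.trans_nonneg _ _ _) (policy_nonneg π s' a')
  unfold stepLaw stepOp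
  have hint : ∀ s' a', Integrable f
      (ENNReal.ofReal (M.trans x.1 x.2 s' * π s' a') • Measure.dirac (s', a')) := fun s' a' =>
    (integrable_dirac (by simp)).smul_measure ENNReal.ofReal_ne_top
  rw [integral_finsetSum_measure
    (fun s' _ => integrable_finsetSum_measure.2 fun a' _ => hint s' a')]
  refine Finset.sum_congr rfl fun s' _ => ?_
  rw [integral_finsetSum_measure (fun a' _ => hint s' a'), Finset.mul_sum]
  refine Finset.sum_congr rfl fun a' _ => ?_
  rw [integral_smul_measure, integral_dirac, ENNReal.toReal_ofReal (hnn _ _), smul_eq_mul, mul_assoc]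

lemma integral_startLaw {S : Type uS} {A : Type uA} [Fintype A]
    [MeasurableSpace S] [MeasurableSingletonClass S]
    [MeasurableSpace A] [MeasurableSingletonClass A] (π : Policy S A) (s : S) (f : S × A → ℝ) :
    ∫ y, f y ∂(startLaw π s) = ∑ a, π s a * f (s, a) := by
  unfold startLaw
  rw [integral_finsetSum_measure fun a _ =>
    (integrable_dirac (by simp)).smul_measure ENNReal.ofReal_ne_top]
  refine Finset.sum_congr rfl fun a _ => ?_
  rw [integral_smul_measure, integral_dirac, ENNReal.toReal_ofReal (policy_nonneg π s a), smul_eq_mul]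

instance (M : RegMDP S A) (π : Policy S A) (μ₀ : Measure (S × A)) [IsProbabilityMeasure μ₀] :
    IsProbabilityMeasure (M.trajectoryLaw π μ₀) := by
  unfold trajectoryLaw; infer_instance

lemma measurable_of_discrete (f : S × A → ℝ) : Measurable f := measurable_of_countable f

lemma map_zero_trajectoryLaw (M : RegMDP S A) (π : Policy S A) (μ₀ : Measure (S × A))
    [IsProbabilityMeasure μ₀] :
    (M.trajectoryLaw π μ₀).map (fun x => x 0) = μ₀ := by
  have h : (fun x : ℕ → S × A => x 0)
      = (fun y : (i : Finset.Iic 0) → S × A => y ⟨0, by simp⟩) ∘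
        Preorder.frestrictLe (π := fun _ => S × A) 0 := rfl
  unfold trajectoryLaw Kernel.trajMeasure
  rw [h, ← Measure.map_map (by fun_prop) (by fun_prop), Measure.map_comp _ _ (by fun_prop),
    Kernel.traj_map_frestrictLe, Kernel.partialTraj_self, Measure.id_comp,
    Measure.map_map (by fun_prop) (by fun_prop)]
  exact Measure.map_id

/-- The joint law of the history up to `t` and the next pair is the history law composed with the
kernel, and the kernel sees only the last pair. Integrating out the next pair therefore applies
`stepOp`. -/
lemma integral_trajectoryLaw_succ (M : RegMDP S A) (π : Policy S A) (μ₀ : Measure (S × A))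
    [IsProbabilityMeasure μ₀] (f : S × A → ℝ) (t : ℕ) :
    ∫ x, f (x (t + 1)) ∂(M.trajectoryLaw π μ₀)
      = ∫ x, M.stepOp π f (x t) ∂(M.trajectoryLaw π μ₀) := by
  have hm := measurable_of_discrete f
  obtain ⟨B, hB⟩ : ∃ B, ∀ x, ‖f x‖ ≤ B := by
    obtain ⟨B, hB⟩ := (Set.finite_range fun x => ‖f x‖).bddAbove
    exact ⟨B, fun x => hB ⟨x, rfl⟩⟩
  have key := Kernel.map_frestrictLe_trajMeasure_compProd_eq_map_trajMeasure
    (X := fun _ => S × A) (μ₀ := μ₀) (κ := M.historyKernel π) (a := t)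
  have h1 : ∫ x, f (x (t + 1)) ∂(M.trajectoryLaw π μ₀)
      = ∫ z, f z.2 ∂((M.trajectoryLaw π μ₀).map
        (fun x ↦ (Preorder.frestrictLe (π := fun _ => S × A) t x, x (t + 1)))) := by
    rw [integral_map (by fun_prop) (by fun_prop)]
  rw [h1]
  unfold trajectoryLaw
  rw [← key, Measure.integral_compProd, integral_map (by fun_prop)]
  · refine integral_congr_ae (Filter.Eventually.of_forall fun x => ?_)
    exact M.integral_stepKernel π f (x t)
  · refine StronglyMeasurable.aestronglyMeasurable ?_
    exact StronglyMeasurable.integral_kernel_prod_right' (f := fun z : _ × (S × A) => f z.2)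
      (hm.comp measurable_snd).stronglyMeasurable
  · exact Integrable.of_bound (hm.comp measurable_snd).aestronglyMeasurable B
      (Filter.Eventually.of_forall fun x => hB _)

lemma integral_trajectoryLaw (M : RegMDP S A) (π : Policy S A) (μ₀ : Measure (S × A))
    [IsProbabilityMeasure μ₀] (t : ℕ) (f : S × A → ℝ) :
    ∫ x, f (x t) ∂(M.trajectoryLaw π μ₀) = ∫ y, ((M.stepOp π)^[t] f) y ∂μ₀ := by
  induction t generalizing f with
  | zero =>
    conv_rhs => rw [← M.map_zero_trajectoryLaw π μ₀]
    rw [integral_map (measurable_pi_apply 0).aemeasurable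
      (measurable_of_discrete _).aestronglyMeasurable]
    rfl
  | succ t ih => rw [integral_trajectoryLaw_succ, ih, Function.iterate_succ_apply]

/-- Single-step costs are bounded and `γ < 1`, so sum and integral commute, both over trajectories
and over the initial pair. The two resulting series agree term by term. -/
lemma integral_discountedCost (M : RegMDP S A) (π : Policy S A) (μ₀ : Measure (S × A))
    [IsProbabilityMeasure μ₀] :
    ∫ x, M.discountedCost π x ∂(M.trajectoryLaw π μ₀)
      = ∫ y, ∑' t, M.γ ^ t * (M.stepOp π)^[t] (M.stepCost π) y ∂μ₀ := by
  obtain ⟨B, hB⟩ := M.exists_stepCost_bound π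
  have aux : ∀ {Y : Type max uS uA} [MeasurableSpace Y] (P : Measure Y) [IsProbabilityMeasure P]
      (u : ℕ → Y → ℝ), (∀ t, Measurable (u t)) → (∀ t y, |u t y| ≤ B) →
      ∫ y, ∑' t, M.γ ^ t * u t y ∂P = ∑' t, M.γ ^ t * ∫ y, u t y ∂P := by
    intro Y _ P _ u hum hu
    have hint : ∀ t, Integrable (u t) P := fun t =>
      Integrable.of_bound (hum t).aestronglyMeasurable B (Filter.Eventually.of_forall (hu t))
    rw [← integral_tsum_of_summable_integral_norm (fun t => (hint t).const_mul _)]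
    · simp_rw [integral_const_mul]
    · simp_rw [norm_mul, integral_const_mul, Real.norm_eq_abs, abs_pow, abs_of_nonneg M.γ_nonneg]
      refine M.summable_discounted (B := B) fun t => ?_
      rw [abs_of_nonneg (integral_nonneg fun _ => abs_nonneg _)]
      calc ∫ y, |u t y| ∂P ≤ ∫ _, B ∂P :=
            integral_mono (hint t).abs (integrable_const _) (hu t)
        _ = B := by simp
  have h1 := aux (M.trajectoryLaw π μ₀) (fun t x => M.stepCost π (x t))
    (fun t => (measurable_of_discrete (M.stepCost π)).comp (measurable_pi_apply t)) (fun t x => hB _)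
  have h2 := aux μ₀ (fun t => (M.stepOp π)^[t] (M.stepCost π))
    (fun t => measurable_of_discrete _) (fun t => M.abs_stepOp_iterate_le π hB t)
  rw [h2]
  simp_rw [← M.integral_trajectoryLaw π μ₀]
  exact h1

lemma Q_eq_tsum (M : RegMDP S A) (π : Policy S A) (s : S) (a : A) :
    M.Q π s a = ∑' t, M.γ ^ t * (M.stepOp π)^[t] (M.stepCost π) (s, a) := by
  rw [Q, integral_discountedCost, integral_dirac]

/-- The value function is the policy average of the action-value function. -/
lemma V_eq_sum_Q (M : RegMDP S A) (π : Policy S A) (s : S) :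
    M.V π s = ∑ a, π s a * M.Q π s a := by
  rw [V, integral_discountedCost, integral_startLaw]
  simp_rw [Q_eq_tsum]

/-- Bellman's equation for the action-value function. -/
lemma Q_eq (M : RegMDP S A) (π : Policy S A) (s : S) (a : A) :
    M.Q π s a = M.cost s a + M.reg s (π s) + M.γ * ∑ s', M.trans s a s' * M.V π s' := by
  obtain ⟨B, hB⟩ := M.exists_stepCost_bound π
  have hs : ∀ x, Summable fun t => M.γ ^ t * (M.stepOp π)^[t] (M.stepCost π) x := fun x =>
    M.summable_discounted fun t => M.abs_stepOp_iterate_le π hB t x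
  rw [Q_eq_tsum, (hs _).tsum_eq_zero_add]
  simp_rw [V_eq_sum_Q, Q_eq_tsum, ← tsum_mul_left]
  simp_rw [← Summable.tsum_finsetSum fun a' (_ : a' ∈ Finset.univ) =>
    (hs (_, a')).mul_left _, ← tsum_mul_left]
  rw [← Summable.tsum_finsetSum fun s' _ =>
    (summable_sum fun a' _ => (hs (_, a')).mul_left _).mul_left _, ← tsum_mul_left]
  -- The term at `t = 0` is the immediate cost; the remaining series is `γ` times one application of
  -- `stepOp` to the series for `Q`.
  simp only [pow_zero, Function.iterate_zero, id, one_mul, stepCost, Function.iterate_succ_apply']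
  congr 2
  funext t
  simp only [stepOp, Finset.mul_sum]
  refine Finset.sum_congr rfl fun s' _ => Finset.sum_congr rfl fun a' _ => ?_
  ring

/-- If the regularized advantage of `π'` over `π` is at least `-g` at every state, then the value of
`π` exceeds that of `π'` by at most `g / (1 - γ)`. -/
lemma V_sub_le (M : RegMDP S A) (π π' : Policy S A) {g : ℝ}
    (hg : ∀ s, ∑ a, M.Q π s a * (π s a - π' s a) + M.reg s (π s) - M.reg s (π' s) ≤ g) (s : S) :
    M.V π s - M.V π' s ≤ (1 - M.γ)⁻¹ * g := by
  have hne : Nonempty S := ⟨s⟩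
  obtain ⟨s₀, hs₀⟩ := Finite.exists_max fun s => M.V π s - M.V π' s
  -- Subtracting the two Bellman equations expresses `Q^{π'}` through `Q^π`, the regularizers at `s`
  -- and the expected next-state value difference; this is then averaged over `π'`.
  have hV' : ∀ s, M.V π' s
      = ∑ a, π' s a * (M.Q π s a) + M.reg s (π' s) - M.reg s (π s)
        - M.γ * ∑ a, π' s a * ∑ s', M.trans s a s' * (M.V π s' - M.V π' s') := by
    intro s
    have h2 : ∀ c : ℝ, c = ∑ a, π' s a * c := fun c => by
      rw [← Finset.sum_mul, policy_sum, one_mul]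
    rw [V_eq_sum_Q, h2 (M.reg s (π' s)), h2 (M.reg s (π s)), Finset.mul_sum,
      ← Finset.sum_add_distrib, ← Finset.sum_sub_distrib, ← Finset.sum_sub_distrib]
    refine Finset.sum_congr rfl fun a _ => ?_
    rw [Q_eq, Q_eq]
    simp_rw [mul_sub, Finset.sum_sub_distrib]
    ring
  -- The next-state difference is bounded by its maximum, attained at `s₀`. Taking `s = s₀` lets the
  -- maximum be solved for.
  have hstep : ∀ s, M.V π s - M.V π' s ≤ g + M.γ * (M.V π s₀ - M.V π' s₀) := by
    intro s
    have h3 : ∑ a, π' s a * ∑ s', M.trans s a s' * (M.V π s' - M.V π' s')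
        ≤ M.V π s₀ - M.V π' s₀ := by
      calc _ ≤ ∑ a, π' s a * (M.V π s₀ - M.V π' s₀) := by
            refine Finset.sum_le_sum fun a _ =>
              mul_le_mul_of_nonneg_left ?_ (policy_nonneg π' s a)
            calc _ ≤ ∑ s', M.trans s a s' * (M.V π s₀ - M.V π' s₀) :=
                  Finset.sum_le_sum fun s' _ =>
                    mul_le_mul_of_nonneg_left (hs₀ s') (M.trans_nonneg _ _ _)
              _ = _ := by rw [← Finset.sum_mul, M.trans_sum, one_mul]
        _ = _ := by
            rw [← Finset.sum_mul, policy_sum, one_mul]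
    have h4 := mul_le_mul_of_nonneg_left h3 M.γ_nonneg
    have h5 := hg s
    have h6 : ∑ a, M.Q π s a * (π s a - π' s a)
        = ∑ a, π s a * M.Q π s a - ∑ a, π' s a * M.Q π s a := by
      rw [← Finset.sum_sub_distrib]
      exact Finset.sum_congr rfl fun a _ => by ring
    have h7 := M.V_eq_sum_Q π s
    have h8 := hV' s
    linarith
  have hγ : 0 < 1 - M.γ := sub_pos.2 M.γ_lt_one
  have h9 : (1 - M.γ) * (M.V π s₀ - M.V π' s₀) ≤ g := by linarith [hstep s₀]
  calc _ ≤ M.V π s₀ - M.V π' s₀ := hs₀ s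
    _ = (1 - M.γ)⁻¹ * ((1 - M.γ) * (M.V π s₀ - M.V π' s₀)) := by field_simp
    _ ≤ _ := mul_le_mul_of_nonneg_left h9 (inv_nonneg.2 hγ.le)

end RegMDP

/-! ### Elementary exponential inequalities. -/

section Scalar

lemma exp_le_add_exp_sq (x : ℝ) : Real.exp x ≤ x + Real.exp (x ^ 2) := by
  have h1 := Real.add_one_le_exp (x ^ 2)
  rcases le_or_gt x (-1) with hx | hx
  · have : Real.exp x ≤ 1 := Real.exp_le_one_iff.2 (by linarith)
    nlinarith
  rcases le_or_gt x 1 with hx' | hx'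
  · have := (abs_le.1 (Real.abs_exp_sub_one_sub_id_le (abs_le.2 ⟨hx.le, hx'⟩))).2
    linarith
  · have : Real.exp x ≤ Real.exp (x ^ 2) := Real.exp_le_exp.2 (by nlinarith)
    linarith

/-- The concave function `t ↦ t ^ α` lies below its tangent at `t = 2`, taken here at `t = exp v`.
Being affine in `exp v`, the majorant stands in for conditional Jensen: a conditional mean of `exp
v` at most `2` gives one of `exp (α v)` at most `2 ^ α`. -/
lemma exp_mul_le_tangent {α : ℝ} (h0 : 0 ≤ α) (h1 : α ≤ 1) (v : ℝ) :
    Real.exp (α * v)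
      ≤ Real.exp (α * Real.log 2) * (1 + α * (Real.exp v / 2 - 1)) := by
  have hb := rpow_one_add_le_one_add_mul_self (s := Real.exp v / 2 - 1)
    (by linarith [Real.exp_pos v]) h0 h1
  have hv : 1 + (Real.exp v / 2 - 1) = Real.exp (v - Real.log 2) := by
    rw [Real.exp_sub, Real.exp_log two_pos]; ring
  rw [hv, ← Real.exp_mul] at hb
  calc Real.exp (α * v) = Real.exp (α * Real.log 2) * Real.exp ((v - Real.log 2) * α) := by
        rw [← Real.exp_add]; ring_nf
    _ ≤ _ := mul_le_mul_of_nonneg_left hb (Real.exp_pos _).le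

lemma exp_add_le_exp_add {u v : ℝ} (hu : 0 ≤ u) (hv : 0 ≤ v) :
    v + Real.exp u ≤ Real.exp (u + v) := by
  have h1 := Real.add_one_le_exp v
  have h2 := Real.one_le_exp hu
  rw [Real.exp_add]
  nlinarith

end Scalar

/-! ### Concentration for adapted light-tailed sequences. -/

section Sequences

variable {Ω : Type uO} {mΩ : MeasurableSpace Ω} {μ : Measure Ω}

/-- A nonnegative factor with conditional expectation at most `c` contributes at most the factor
`c` to the integral of a product with a function measurable in the conditioning σ-algebra. -/
lemma lintegral_mul_ofReal_le_of_condExp_le [IsFiniteMeasure μ] {m : MeasurableSpace Ω}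
    (hm : m ≤ mΩ) {g : Ω → ℝ} (hg0 : ∀ w, 0 ≤ g w) {c : ℝ} (hg : CondExpLE m μ g c)
    {f : Ω → ENNReal} (hf : Measurable[m] f) :
    ∫⁻ w, f w * ENNReal.ofReal (g w) ∂μ ≤ ENNReal.ofReal c * ∫⁻ w, f w ∂μ := by
  obtain ⟨hint, hc⟩ := hg
  -- On sets of `m`, the measure with density `g` is at most `c` times `μ`. Comparing measures
  -- allows any `m`-measurable `f`, with no integrability of the product.
  have hle : (μ.withDensity fun w => ENNReal.ofReal (g w)).trim hm
      ≤ ENNReal.ofReal c • μ.trim hm := by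
    refine Measure.le_iff.2 fun s hs => ?_
    rw [trim_measurableSet_eq hm hs, withDensity_apply _ (hm s hs), Measure.smul_apply,
      trim_measurableSet_eq hm hs, smul_eq_mul,
      ← ofReal_integral_eq_lintegral_ofReal hint.integrableOn
        (Filter.Eventually.of_forall hg0), ← setIntegral_condExp hm hint hs]
    calc ENNReal.ofReal (∫ w in s, (μ[g | m]) w ∂μ)
        ≤ ENNReal.ofReal (∫ _ in s, c ∂μ) := by
          refine ENNReal.ofReal_le_ofReal ?_
          refine integral_mono_ae integrable_condExp.integrableOn (integrable_const _) ?_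
          exact ae_restrict_of_ae hc
      _ = ENNReal.ofReal c * μ s := by
          rw [setIntegral_const, smul_eq_mul, mul_comm, ENNReal.ofReal_mul' measureReal_nonneg,
            ofReal_measureReal]
  have hmeas : AEMeasurable (fun w => ENNReal.ofReal (g w)) μ :=
    hint.aestronglyMeasurable.aemeasurable.ennreal_ofReal
  calc ∫⁻ w, f w * ENNReal.ofReal (g w) ∂μ
      = ∫⁻ w, f w ∂(μ.withDensity fun w => ENNReal.ofReal (g w)) := by
        rw [lintegral_withDensity_eq_lintegral_mul₀ hmeas (hf.mono hm le_rfl).aemeasurable]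
        exact lintegral_congr fun w => mul_comm _ _
    _ = ∫⁻ w, f w ∂((μ.withDensity fun w => ENNReal.ofReal (g w)).trim hm) :=
        (lintegral_trim hm hf).symm
    _ ≤ ∫⁻ w, f w ∂(ENNReal.ofReal c • μ.trim hm) := lintegral_mono' hle le_rfl
    _ = _ := by rw [lintegral_smul_measure, lintegral_trim hm hf, smul_eq_mul]

/-- The expectation of a product of adapted nonnegative factors whose conditional expectations are
at most `c` is at most the corresponding power of `c`. -/
lemma lintegral_prod_le_pow [IsProbabilityMeasure μ] {F : ℕ → MeasurableSpace Ω}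
    (hF : ∀ t, F t ≤ mΩ) (hmono : Monotone F) {g : ℕ → Ω → ℝ} (hg0 : ∀ t w, 0 ≤ g t w)
    (hgm : ∀ t, Measurable[F (t + 1)] (g t)) {c : ℝ} {N : ℕ}
    (hg : ∀ t < N, CondExpLE (F t) μ (g t) c) :
    ∫⁻ w, ENNReal.ofReal (∏ t ∈ Finset.range N, g t w) ∂μ ≤ ENNReal.ofReal c ^ N := by
  induction N with
  | zero => simp
  | succ N ih =>
    have hp : Measurable[F N] fun w => ENNReal.ofReal (∏ t ∈ Finset.range N, g t w) := by
      refine Measurable.ennreal_ofReal ?_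
      refine Finset.measurable_fun_prod _ fun t ht => ?_
      exact (hgm t).mono (hmono (Finset.mem_range.1 ht)) le_rfl
    simp_rw [Finset.prod_range_succ,
      ENNReal.ofReal_mul (Finset.prod_nonneg fun t _ => hg0 t _)]
    calc _ ≤ ENNReal.ofReal c * ∫⁻ w, ENNReal.ofReal (∏ t ∈ Finset.range N, g t w) ∂μ :=
          lintegral_mul_ofReal_le_of_condExp_le (hF N) (hg0 N) (hg N N.lt_succ_self) hp
      _ ≤ ENNReal.ofReal c * ENNReal.ofReal c ^ N := by
          gcongr
          exact ih fun t ht => hg t (ht.trans N.lt_succ_self)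
      _ = _ := by rw [pow_succ, mul_comm]

/-- Markov's inequality for `exp Y`: the common form of both tail estimates below. -/
lemma measure_le_of_lintegral_exp_le {Y : Ω → ℝ} (hY : Measurable Y) {a b : ℝ}
    (h : ∫⁻ w, ENNReal.ofReal (Real.exp (Y w)) ∂μ ≤ ENNReal.ofReal (Real.exp b)) :
    μ {w | a ≤ Y w} ≤ ENNReal.ofReal (Real.exp (b - a)) := by
  have h1 := mul_meas_ge_le_lintegral (μ := μ)
    (f := fun w => ENNReal.ofReal (Real.exp (Y w))) (by fun_prop) (ENNReal.ofReal (Real.exp a))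
  have h2 : {w | a ≤ Y w}
      = {w | ENNReal.ofReal (Real.exp a) ≤ ENNReal.ofReal (Real.exp (Y w))} := by
    ext w
    simp [ENNReal.ofReal_le_ofReal_iff (Real.exp_pos _).le]
  rw [h2, sub_eq_add_neg, Real.exp_add, ENNReal.ofReal_mul (Real.exp_pos _).le, Real.exp_neg,
    ENNReal.ofReal_inv_of_pos (Real.exp_pos _), ← div_eq_mul_inv,
    ENNReal.le_div_iff_mul_le (Or.inl (by simp [Real.exp_pos])) (Or.inl ENNReal.ofReal_ne_top),
    mul_comm]
  exact h1.trans h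

lemma CondSubgaussian.of_abs_le {m : MeasurableSpace Ω} {f g : Ω → ℝ} {c : ℝ}
    (hf : CondSubgaussian m μ f c) (hg : Measurable[mΩ] g) (h : ∀ w, |g w| ≤ f w) :
    CondSubgaussian m μ g c := by
  obtain ⟨⟨hint, hle⟩, h0⟩ := hf
  have hexp : ∀ w, Real.exp (g w ^ 2 / c ^ 2) ≤ Real.exp (f w ^ 2 / c ^ 2) := fun w => by
    have : g w ^ 2 ≤ f w ^ 2 := sq_le_sq' (abs_le.1 (h w)).1 (abs_le.1 (h w)).2
    gcongr
  have hint' : Integrable (fun w => Real.exp (g w ^ 2 / c ^ 2)) μ := by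
    refine hint.mono'
      (Real.measurable_exp.comp ((hg.pow_const 2).div_const _)).aestronglyMeasurable (Filter.Eventually.of_forall fun w => ?_)
    rw [Real.norm_eq_abs, Real.abs_exp]
    exact hexp w
  refine ⟨⟨hint', ?_⟩, fun hc => ?_⟩
  · filter_upwards [hle, condExp_mono (m := m) hint' hint (Filter.Eventually.of_forall hexp)]
      with w h1 h2
    exact h2.trans h1
  · filter_upwards [h0 hc] with w hw
    exact abs_nonpos_iff.1 (hw ▸ h w)

/-- The conditional moment generating function of a light-tailed variable with small conditional
mean. -/
lemma CondSubgaussian.condExpLE_exp [IsProbabilityMeasure μ] {m : MeasurableSpace Ω} (hm : m ≤ mΩ)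
    {X : Ω → ℝ} {σ ς θ : ℝ} (hσ : 0 < σ) (hς : 0 ≤ ς) (hθ : 0 ≤ θ) (hθσ : θ * σ ≤ 1)
    (hX : Integrable X μ) (hbias : ∀ᵐ w ∂μ, (μ[X | m]) w ≤ ς) (hsub : CondSubgaussian m μ X σ) :
    CondExpLE m μ (fun w => Real.exp (θ * X w))
      (Real.exp (7 / 10 * (θ * σ) ^ 2 + θ * ς)) := by
  obtain ⟨⟨hint, hle⟩, -⟩ := hsub
  set α := (θ * σ) ^ 2 with hα
  have hα0 : 0 ≤ α := sq_nonneg _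
  have hα1 : α ≤ 1 := pow_le_one₀ (by positivity) hθσ
  set k := Real.exp (α * Real.log 2) with hk
  have hk0 : 0 < k := Real.exp_pos _
  set E : Ω → ℝ := fun w => Real.exp (X w ^ 2 / σ ^ 2) with hE
  -- A majorant of `exp (θ X)` linear in `X` and `E`, whose conditional means are controlled. It
  -- combines `exp x ≤ x + exp (x²)` at `x = θ X` with the tangent bound, since `(θ X)² = α X² /
  -- σ²`.
  set R : Ω → ℝ := θ • X + ((fun _ => k * (1 - α)) + (k * α / 2) • E) with hR
  have hpt : ∀ w, Real.exp (θ * X w) ≤ R w := fun w => by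
    have h1 := exp_le_add_exp_sq (θ * X w)
    have h2 := exp_mul_le_tangent hα0 hα1 (X w ^ 2 / σ ^ 2)
    have h3 : α * (X w ^ 2 / σ ^ 2) = (θ * X w) ^ 2 := by rw [hα]; field_simp
    rw [h3] at h2
    simp only [hR, hE, Pi.add_apply, Pi.smul_apply, smul_eq_mul]
    linarith
  have hRi : Integrable R μ := (hX.smul θ).add ((integrable_const _).add (hint.smul _))
  have hexpi : Integrable (fun w => Real.exp (θ * X w)) μ := by
    refine hRi.mono' ?_ (Filter.Eventually.of_forall fun w => ?_)
    · exact Real.continuous_exp.comp_aestronglyMeasurable (hX.aestronglyMeasurable.const_mul θ)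
    · rw [Real.norm_eq_abs, Real.abs_exp]; exact hpt w
  refine ⟨hexpi, ?_⟩
  filter_upwards [hle, hbias, condExp_mono (m := m) hexpi hRi (Filter.Eventually.of_forall hpt),
    condExp_add (hX.smul θ) ((integrable_const (k * (1 - α))).add (hint.smul (k * α / 2))) m,
    condExp_add (integrable_const (k * (1 - α))) (hint.smul (k * α / 2)) m,
    condExp_smul (μ := μ) θ X m, condExp_smul (μ := μ) (k * α / 2) E m]
    with w h1 h2 h3 h4 h5 h6 h7
  rw [Pi.add_apply] at h4 h5
  rw [Pi.smul_apply, smul_eq_mul] at h6 h7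
  have h8 : (μ[fun _ => k * (1 - α) | m]) w = k * (1 - α) := by rw [condExp_const hm]
  rw [h6, h5, h7, h8] at h4
  have h9 := mul_le_mul_of_nonneg_left h2 hθ
  have h10 := mul_le_mul_of_nonneg_left h1 (by positivity : 0 ≤ k * α / 2)
  -- The constant `7 / 10` is a rational upper bound for `log 2`.
  have h11 : k ≤ Real.exp (7 / 10 * α) := by
    refine Real.exp_le_exp.2 ?_
    nlinarith [Real.log_two_lt_d9]
  have h12 := exp_add_le_exp_add (by positivity : 0 ≤ 7 / 10 * α) (mul_nonneg hθ hς)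
  calc _ ≤ _ := h3
    _ = _ := h4
    _ ≤ θ * ς + k := by linarith
    _ ≤ _ := by linarith

/-- An adapted process whose first `N` terms have conditional mean at most `ς` and conditionally
light tails. -/
structure IsLightTailedSeq (μ : Measure Ω) (F : ℕ → MeasurableSpace Ω) (N : ℕ)
    (X : ℕ → Ω → ℝ) (ς σ : ℝ) : Prop where
  le : ∀ t, F t ≤ mΩ
  mono : Monotone F
  adapted : ∀ t, Measurable[F (t + 1)] (X t)
  integrable : ∀ t < N, Integrable (X t) μ
  bias : ∀ t < N, ∀ᵐ w ∂μ, (μ[X t | F t]) w ≤ ς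
  tail : ∀ t < N, CondSubgaussian (F t) μ (X t) σ

namespace IsLightTailedSeq

variable {F : ℕ → MeasurableSpace Ω} {N : ℕ} {X : ℕ → Ω → ℝ} {ς σ : ℝ}

lemma measurable (h : IsLightTailedSeq μ F N X ς σ) (t : ℕ) : Measurable (X t) :=
  (h.adapted t).mono (h.le _) le_rfl

lemma measurable_sum (h : IsLightTailedSeq μ F N X ς σ) :
    Measurable fun w => ∑ t ∈ Finset.range N, X t w :=
  Finset.measurable_fun_sum _ fun t _ => h.measurable t

/-- For `σ = 0` the quotient in the exponential moment is `0` by convention and carries no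
information, so this case rests on the separate vanishing clause of `CondSubgaussian`. -/
lemma ae_sum_eq_zero (h : IsLightTailedSeq μ F N X ς σ) (hσ : σ = 0) :
    ∀ᵐ w ∂μ, ∑ t ∈ Finset.range N, X t w = 0 := by
  have : ∀ᵐ w ∂μ, ∀ t < N, X t w = 0 :=
    ae_all_iff.2 fun t => by
      by_cases ht : t < N
      · filter_upwards [(h.tail t ht).2 hσ] with w hw _ using hw
      · exact Filter.Eventually.of_forall fun w h' => absurd h' ht
  filter_upwards [this] with w hw
  exact Finset.sum_eq_zero fun t ht => hw t (Finset.mem_range.1 ht)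

variable [IsProbabilityMeasure μ]

lemma lintegral_exp_sum_le (h : IsLightTailedSeq μ F N X ς σ) (hσ : 0 < σ) (hς : 0 ≤ ς)
    {θ : ℝ} (hθ : 0 ≤ θ) (hθσ : θ * σ ≤ 1) :
    ∫⁻ w, ENNReal.ofReal (Real.exp (θ * ∑ t ∈ Finset.range N, X t w)) ∂μ
      ≤ ENNReal.ofReal (Real.exp (N * (7 / 10 * (θ * σ) ^ 2 + θ * ς))) := by
  have h1 := lintegral_prod_le_pow (μ := μ) h.le h.mono (g := fun t w => Real.exp (θ * X t w))
    (fun t w => (Real.exp_pos _).le)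
    (fun t => Real.measurable_exp.comp ((h.adapted t).const_mul θ)) (N := N)
    fun t ht => (h.tail t ht).condExpLE_exp (h.le t) hσ hς hθ hθσ (h.integrable t ht) (h.bias t ht)
  rw [← ENNReal.ofReal_pow (Real.exp_pos _).le, ← Real.exp_nat_mul] at h1
  simpa only [Finset.mul_sum, Real.exp_sum] using h1

lemma lintegral_exp_sum_sq_le (h : IsLightTailedSeq μ F N X ς σ) :
    ∫⁻ w, ENNReal.ofReal (Real.exp (∑ t ∈ Finset.range N, X t w ^ 2 / σ ^ 2)) ∂μ
      ≤ ENNReal.ofReal (Real.exp (N * Real.log 2)) := by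
  have h1 := lintegral_prod_le_pow (μ := μ) h.le h.mono
    (g := fun t w => Real.exp (X t w ^ 2 / σ ^ 2))
    (fun t w => (Real.exp_pos _).le)
    (fun t => Real.measurable_exp.comp (((h.adapted t).pow_const 2).div_const _)) (N := N)
    fun t ht => (h.tail t ht).1
  rw [← ENNReal.ofReal_pow zero_le_two] at h1
  rw [Real.exp_nat_mul, Real.exp_log two_pos]
  simpa only [Real.exp_sum] using h1

/-- Large deviations of the sum of a light-tailed process whose total bias is at most `σ`. -/
lemma measure_sum_gt_le (h : IsLightTailedSeq μ F N X ς σ) (hN : 0 < N) (hσ : 0 ≤ σ)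
    (hς : 0 ≤ ς) (hbias : N * ς ≤ σ) {L : ℝ} (hL : Real.log 4 ≤ L) :
    μ {w | σ * √(3 * L * N) < ∑ t ∈ Finset.range N, X t w}
      ≤ ENNReal.ofReal (2 * Real.exp (-L)) := by
  have hlog4 : Real.log 4 = 2 * Real.log 2 := by
    rw [show (4 : ℝ) = 2 ^ 2 by norm_num, Real.log_pow]; norm_num
  have hl2 := Real.log_two_gt_d9
  have hl2' := Real.log_two_lt_d9
  have hL0 : 0 < L := by linarith
  have hN' : (0 : ℝ) < N := Nat.cast_pos.2 hN
  rcases hσ.eq_or_lt with hσ0 | hσ0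
  · rw [measure_eq_zero_iff_ae_notMem.2]
    · exact zero_le
    · filter_upwards [h.ae_sum_eq_zero hσ0.symm] with w hw
      simp [hw, ← hσ0]
  have hsq : √(3 * L * N) ^ 2 = 3 * L * N := Real.sq_sqrt (by positivity)
  -- For `N` small relative to `L` the linear Chernoff parameter could violate `θ σ ≤ 1`. There
  -- Cauchy–Schwarz forces `∑ X² / σ² ≥ 3 L`, whose probability is at most `2 ^ N exp (-3 L) ≤ exp
  -- (-L)`.
  rcases le_or_gt (N * Real.log 2) (2 * L) with hcase | hcase
  · have h1 := measure_le_of_lintegral_exp_le (a := 3 * L)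
      (Finset.measurable_fun_sum _ fun t _ => ((h.measurable t).pow_const 2).div_const _)
      h.lintegral_exp_sum_sq_le
    refine (measure_mono fun w hw => ?_).trans (h1.trans (ENNReal.ofReal_le_ofReal ?_))
    · have hw' : σ * √(3 * L * N) < ∑ t ∈ Finset.range N, X t w := hw
      have h2 : (σ * √(3 * L * N)) ^ 2 ≤ (∑ t ∈ Finset.range N, X t w) ^ 2 :=
        pow_le_pow_left₀ (by positivity) hw'.le 2
      have h3 := sq_sum_le_card_mul_sum_sq (s := Finset.range N) (f := fun t => X t w)
      rw [Finset.card_range] at h3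
      rw [mul_pow, hsq] at h2
      change 3 * L ≤ ∑ t ∈ Finset.range N, X t w ^ 2 / σ ^ 2
      rw [← Finset.sum_div, le_div_iff₀ (by positivity)]
      refine le_of_mul_le_mul_left ?_ hN'
      linarith
    · have : Real.exp (N * Real.log 2 - 3 * L) ≤ Real.exp (-L) :=
        Real.exp_le_exp.2 (by linarith)
      linarith [Real.exp_pos (-L)]
  · set r := √(3 * L * N) with hr
    have hr0 : 0 ≤ r := Real.sqrt_nonneg _
    -- In this case `3 L < (3 / 2) N log 2`, and `(3 / 2) log 2 < (51 / 50)²`.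
    have hrN : r ≤ 51 / 50 * N := by
      refine Real.sqrt_le_iff.2 ⟨by positivity, ?_⟩
      nlinarith
    -- The minimizer of the bias-free Chernoff exponent `(7 / 10) N (θ σ)² - θ σ r`, with minimum
    -- `-(5 / 14) r² / N = -(15 / 14) L`.
    set θ := r / (7 / 5 * σ * N) with hθ
    have hθσ : θ * σ = r / (7 / 5 * N) := by rw [hθ]; field_simp
    have hu : θ * σ ≤ 73 / 100 := by
      rw [hθσ, div_le_iff₀ (by positivity)]
      linarith
    have hθ0 : 0 ≤ θ := by positivity
    have h1 := measure_le_of_lintegral_exp_le (a := θ * (σ * r))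
      (h.measurable_sum.const_mul θ) (h.lintegral_exp_sum_le hσ0 hς hθ0 (by linarith))
    refine (measure_mono fun w hw => ?_).trans (h1.trans (ENNReal.ofReal_le_ofReal ?_))
    · exact mul_le_mul_of_nonneg_left (le_of_lt hw) hθ0
    · have h2 : N * (7 / 10 * (θ * σ) ^ 2 + θ * ς) - θ * (σ * r)
          = θ * (N * ς) - 15 / 14 * L := by
        have h4 : N * (7 / 10 * (θ * σ) ^ 2) - θ * σ * r = -(5 / 14) * (r ^ 2 / N) := by
          rw [hθσ]; field_simp; ring
        have h5 : r ^ 2 / N = 3 * L := by rw [hsq]; field_simp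
        rw [h5] at h4
        linear_combination h4
      -- The bias costs at most `θ σ ≤ 73 / 100`. This is absorbed by the prefactor `2` and the
      -- spare `L / 14`, where `L ≥ log 4` enters.
      have h3 : θ * (N * ς) ≤ θ * σ := mul_le_mul_of_nonneg_left hbias hθ0
      calc Real.exp (N * (7 / 10 * (θ * σ) ^ 2 + θ * ς) - θ * (σ * r))
          ≤ Real.exp (Real.log 2 + -L) := Real.exp_le_exp.2 (by rw [h2]; linarith)
        _ = 2 * Real.exp (-L) := by rw [Real.exp_add, Real.exp_log two_pos]

/-- The exponential moment of the normalized sum. -/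
lemma integral_exp_normalized_sum_le (h : IsLightTailedSeq μ F N X ς σ) (hN : 0 < N)
    (hσ : 0 < σ) (hς : 0 ≤ ς) (hbias : N * ς ≤ σ) :
    Integrable (fun w => Real.exp ((σ * √N)⁻¹ * ∑ t ∈ Finset.range N, X t w)) μ ∧
      ∫ w, Real.exp ((σ * √N)⁻¹ * ∑ t ∈ Finset.range N, X t w) ∂μ ≤ 37 / 5 := by
  have hN' : (1 : ℝ) ≤ √N := Real.one_le_sqrt.2 (by exact_mod_cast hN)
  have hsq : √(N : ℝ) ^ 2 = N := Real.sq_sqrt (Nat.cast_nonneg N)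
  have hθσ : (σ * √N)⁻¹ * σ = (√N)⁻¹ := by field_simp
  have hinv : (√(N : ℝ))⁻¹ ≤ 1 := inv_le_one_of_one_le₀ hN'
  have hm : Measurable fun w => Real.exp ((σ * √N)⁻¹ * ∑ t ∈ Finset.range N, X t w) :=
    Real.measurable_exp.comp (h.measurable_sum.const_mul _)
  have h1 := h.lintegral_exp_sum_le hσ hς (θ := (σ * √N)⁻¹) (by positivity) (hθσ.trans_le hinv)
  -- The quadratic term is exactly `7 / 10` and the bias term at most `1 / √N ≤ 1`.
  have hexp : N * (7 / 10 * ((σ * √N)⁻¹ * σ) ^ 2 + (σ * √N)⁻¹ * ς) ≤ 2 := by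
    have h2 : (N : ℝ) * ((√N)⁻¹) ^ 2 = 1 := by rw [inv_pow, hsq]; field_simp
    have h3 : (σ * √N)⁻¹ * (N * ς) ≤ (σ * √N)⁻¹ * σ :=
      mul_le_mul_of_nonneg_left hbias (by positivity)
    rw [hθσ] at h3 ⊢
    nlinarith
  have hI : Integrable (fun w => Real.exp ((σ * √N)⁻¹ * ∑ t ∈ Finset.range N, X t w)) μ := by
    refine ⟨hm.aestronglyMeasurable, ?_⟩
    rw [hasFiniteIntegral_iff_ofReal (Filter.Eventually.of_forall fun w => (Real.exp_pos _).le)]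
    exact h1.trans_lt ENNReal.ofReal_lt_top
  refine ⟨hI, ?_⟩
  rw [← ofReal_integral_eq_lintegral_ofReal hI
    (Filter.Eventually.of_forall fun w => (Real.exp_pos _).le),
    ENNReal.ofReal_le_ofReal_iff (Real.exp_pos _).le] at h1
  have h4 : Real.exp 2 ≤ 37 / 5 := by
    have h5 : Real.exp 2 = Real.exp 1 ^ 2 := by rw [← Real.exp_nat_mul]; norm_num
    rw [h5]
    nlinarith [Real.exp_one_lt_d9, Real.exp_pos 1]
  exact h1.trans ((Real.exp_le_exp.2 hexp).trans h4)

end IsLightTailedSeq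

end Sequences

/-! ### Duality between the norm and the estimates. -/

section DualNorm

variable {S : Type uS} {A : Type uA} [Fintype S] [Fintype A]

/-- A definite seminorm in finite dimension has a positive minimum on the compact unit sphere. This
bounds the unit ball of `ν`, so the supremum defining `dualNorm` is a genuine one and not the
default value. -/
lemma Seminorm.exists_mul_norm_le [Nonempty A] (ν : Seminorm ℝ (A → ℝ))
    (hν : ∀ x, ν x = 0 → x = 0) : ∃ c > 0, ∀ x, c * ‖x‖ ≤ ν x := by
  have hcont : Continuous ν := continuousOn_univ.1 (ν.convexOn.continuousOn isOpen_univ)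
  obtain ⟨x₀, hx₀, hmin⟩ := (isCompact_sphere (0 : A → ℝ) 1).exists_isMinOn
    (NormedSpace.sphere_nonempty.2 zero_le_one) hcont.continuousOn
  have hx₀' : ‖x₀‖ = 1 := by simpa using hx₀
  refine ⟨ν x₀, (apply_nonneg ν x₀).lt_of_ne' fun h => ?_, fun x => ?_⟩
  · rw [hν _ h, norm_zero] at hx₀'
    exact zero_ne_one hx₀'
  · rcases eq_or_ne x 0 with rfl | hx
    · simp
    have hn : 0 < ‖x‖ := norm_pos_iff.2 hx
    have h1 : ν x₀ ≤ ν (‖x‖⁻¹ • x) := hmin (by simp [norm_smul, hn.ne'])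
    rw [map_smul_eq_mul, norm_inv, norm_norm, inv_mul_eq_div, le_div_iff₀ hn] at h1
    exact h1

lemma sum_mul_le_dualNorm [Nonempty A] {ν : Seminorm ℝ (A → ℝ)} (hν : ∀ x, ν x = 0 → x = 0)
    (y : A → ℝ) {x : A → ℝ} (hx : ν x ≤ 1) : ∑ a, y a * x a ≤ dualNorm ν y := by
  obtain ⟨c, hc, hle⟩ := ν.exists_mul_norm_le hν
  refine le_csSup ⟨(∑ a, |y a|) * c⁻¹, ?_⟩ ⟨x, hx, rfl⟩
  rintro _ ⟨z, hz, rfl⟩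
  rw [Finset.sum_mul]
  refine Finset.sum_le_sum fun a _ => ?_
  have h1 : ‖z‖ ≤ c⁻¹ := by
    rw [← one_div, le_div_iff₀' hc]
    exact (hle z).trans hz
  calc y a * z a ≤ |y a| * |z a| := (le_abs_self _).trans (abs_mul _ _).le
    _ ≤ _ := mul_le_mul_of_nonneg_left ((norm_le_pi_norm z a).trans h1) (abs_nonneg _)

lemma abs_sum_mul_le_maxDualNorm [Nonempty A] {ν : Seminorm ℝ (A → ℝ)}
    (hν : ∀ x, ν x = 0 → x = 0) (q : S → A → ℝ) (s : S) {x : A → ℝ} (hx : ν x ≤ 1) :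
    |∑ a, q s a * x a| ≤ maxDualNorm ν q := by
  have h1 : dualNorm ν (q s) ≤ maxDualNorm ν q :=
    le_ciSup (f := fun s => dualNorm ν (q s)) (Set.finite_range _).bddAbove s
  refine abs_le'.2 ⟨(sum_mul_le_dualNorm hν _ hx).trans h1, ?_⟩
  have h2 := (sum_mul_le_dualNorm hν (q s) (x := -x) (by rwa [map_neg_eq_map])).trans h1
  simpa using h2

end DualNorm

/-! ### Reduction of the offline estimate to two scalar error sums. -/

section Estimates

variable {S : Type uS} {A : Type uA} [Fintype S] [Fintype A]

/-- The pairing of the estimation errors with a fixed direction is a light-tailed process. -/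
lemma LightTailAssumption.isLightTailedSeq [Nonempty A] {Ω : Type uO} [MeasurableSpace Ω] {μ : Measure Ω}
    [IsProbabilityMeasure μ] {X : Type uX} [MeasurableSpace X] {ξ : ℕ → Ω → X}
    (hξ : ∀ t, Measurable (ξ t)) {est : ℕ → X → S → A → ℝ}
    (hest : ∀ t s a, Measurable (fun x => est t x s a)) {N : ℕ}
    {ν : Seminorm ℝ (A → ℝ)} (hν : ∀ x, ν x = 0 → x = 0) {Q : S → A → ℝ} {ς σ Qbar : ℝ}
    (h : LightTailAssumption μ (pastSigma ξ) N ν Q (fun t w => est t (ξ t w)) ς σ Qbar)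
    (s : S) {p : A → ℝ} (hp : ν p ≤ 1) :
    IsLightTailedSeq μ (pastSigma ξ) N
      (fun t w => ∑ a, (est t (ξ t w) s a - Q s a) * p a) ς σ := by
  have hle : ∀ t, pastSigma ξ t ≤ _ := fun t => iSup₂_le fun i _ => (hξ i).comap_le
  have had : ∀ t, Measurable[pastSigma ξ (t + 1)]
      fun w => ∑ a, (est t (ξ t w) s a - Q s a) * p a := fun t => by
    have h1 : Measurable fun x => ∑ a, (est t x s a - Q s a) * p a :=
      Finset.measurable_fun_sum _ fun a _ => ((hest t s a).sub_const _).mul_const _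
    have h2 : Measurable[pastSigma ξ (t + 1)] (ξ t) :=
      measurable_iff_comap_le.2
        (le_iSup₂_of_le (f := fun i (_ : i < t + 1) => MeasurableSpace.comap (ξ i) _)
          t t.lt_succ_self le_rfl)
    exact h1.comp h2
  refine ⟨hle, fun i j hij => biSup_mono fun k hk => lt_of_lt_of_le hk hij, had, fun t ht => ?_,
    fun t ht => ?_, fun t ht => ?_⟩
  · exact integrable_finsetSum _ fun a _ =>
      (((h.bias t ht).1 s a).sub (integrable_const _)).mul_const _
  -- Conditional expectation commutes with the finite pairing, so the conditional mean is the
  -- pairing of `p` with the bias vector, bounded by its dual norm.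
  · have hint := (h.bias t ht).1 s
    have hterm : ∀ a, μ[fun w => (est t (ξ t w) s a - Q s a) * p a | pastSigma ξ t]
        =ᵐ[μ] fun w =>
          ((μ[fun w' => est t (ξ t w') s a | pastSigma ξ t]) w - Q s a) * p a := fun a => by
      have e1 : (fun w => (est t (ξ t w) s a - Q s a) * p a)
          = p a • ((fun w => est t (ξ t w) s a) - fun _ => Q s a) := by
        ext w; simp [mul_comm]
      rw [e1]
      filter_upwards [condExp_smul (μ := μ) (p a)
        ((fun w => est t (ξ t w) s a) - fun _ => Q s a) (pastSigma ξ t),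
        condExp_sub (hint a) (integrable_const (Q s a)) (pastSigma ξ t)] with w h1 h2
      rw [h1, Pi.smul_apply, h2, Pi.sub_apply, condExp_const (hle t), smul_eq_mul, mul_comm]
    have hsum : μ[fun w => ∑ a, (est t (ξ t w) s a - Q s a) * p a | pastSigma ξ t]
        =ᵐ[μ] ∑ a, μ[fun w => (est t (ξ t w) s a - Q s a) * p a | pastSigma ξ t] := by
      have e2 : (fun w => ∑ a, (est t (ξ t w) s a - Q s a) * p a)
          = ∑ a, fun w => (est t (ξ t w) s a - Q s a) * p a := by
        ext w; simp
      rw [e2]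
      exact condExp_finsetSum
        (fun a _ => ((hint a).sub (integrable_const _)).mul_const _) _
    filter_upwards [hsum, ae_all_iff.2 hterm, (h.bias t ht).2] with w h1 h2 h3
    rw [h1, Finset.sum_apply]
    simp_rw [h2]
    exact (le_abs_self _).trans ((abs_sum_mul_le_maxDualNorm hν
      (fun s a => (μ[fun w' => est t (ξ t w') s a | pastSigma ξ t]) w - Q s a) s hp).trans h3)
  · exact (h.noise_tail t ht).of_abs_le ((had t).mono (hle _) le_rfl) fun w =>
      abs_sum_mul_le_maxDualNorm hν (fun s a => est t (ξ t w) s a - Q s a) s hp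

namespace RegMDP

/-- The supremum over the simplex of `-⟨y, p⟩ - n h^p(s)`. -/
def conjugateReg (M : RegMDP S A) (n : ℕ) (s : S) (y : A → ℝ) : ℝ :=
  ⨆ p : stdSimplex ℝ A, (-∑ a, y a * p a - n * M.reg s p)

lemma neg_norm_le_sum_mul {A : Type uA} [Fintype A] (y : A → ℝ) (p : stdSimplex ℝ A) : -‖y‖ ≤ ∑ a, y a * p a := by
  have h1 : ∑ a, p a = 1 := p.2.2
  calc -‖y‖ = ∑ a, -‖y‖ * p a := by rw [← Finset.mul_sum, h1, mul_one]
    _ ≤ _ := Finset.sum_le_sum fun a _ => mul_le_mul_of_nonneg_right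
      (neg_le_of_abs_le (norm_le_pi_norm y a)) (p.2.1 a)

/-- A lower semicontinuous regularizer is bounded below on the compact simplex. -/
lemma bddAbove_conjugateReg (M : RegMDP S A) (n : ℕ) (s : S) (y : A → ℝ) :
    BddAbove (Set.range fun p : stdSimplex ℝ A => -∑ a, y a * p a - n * M.reg s p) := by
  obtain ⟨b, hb⟩ := (M.reg_closed s).bddBelow_of_isCompact (isCompact_stdSimplex ℝ A)
  refine ⟨‖y‖ - n * b, ?_⟩
  rintro _ ⟨p, rfl⟩
  have h1 : b ≤ M.reg s p := hb ⟨p, p.2, rfl⟩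
  have h2 : (n : ℝ) * b ≤ n * M.reg s p := mul_le_mul_of_nonneg_left h1 (Nat.cast_nonneg n)
  have h3 := neg_norm_le_sum_mul y p
  dsimp only
  linarith

/-- A supremum of functions of `y` that are each `1`-Lipschitz in the sup norm, `p` being a
probability vector. Continuity settles measurability of the gap, a supremum over a possibly
uncountable simplex. -/
lemma lipschitzWith_conjugateReg [Nonempty A] (M : RegMDP S A) (n : ℕ) (s : S) :
    LipschitzWith 1 (M.conjugateReg n s) := by
  refine LipschitzWith.of_le_add fun x y => ?_
  refine ciSup_le fun p => ?_
  have h1 := le_ciSup (M.bddAbove_conjugateReg n s y) p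
  have h2 := neg_norm_le_sum_mul (x - y) p
  simp only [Pi.sub_apply, sub_mul, Finset.sum_sub_distrib] at h2
  rw [dist_eq_norm]
  unfold conjugateReg
  linarith

lemma neg_sum_noisyAdvantage (M : RegMDP S A) (π : Policy S A) (N : ℕ) (q : ℕ → S → A → ℝ)
    (s : S) (p : A → ℝ) :
    -∑ t ∈ Finset.range N, M.noisyAdvantage π (q t) s p
      = (-∑ a, (∑ t ∈ Finset.range N, q t s a) * p a - N * M.reg s p)
        + (∑ t ∈ Finset.range N, noisyValue π (q t) s + N * M.reg s (π s)) := by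
  simp only [noisyAdvantage, Finset.sum_sub_distrib, Finset.sum_add_distrib, Finset.sum_const,
    Finset.card_range, nsmul_eq_mul, Finset.sum_mul]
  rw [Finset.sum_comm]
  ring

lemma offlineGap_eq [Nonempty A] (M : RegMDP S A) (π : Policy S A) (N : ℕ) (q : ℕ → S → A → ℝ) (s : S) :
    M.offlineGap π N q s
      = (N : ℝ)⁻¹ * (M.conjugateReg N s (fun a => ∑ t ∈ Finset.range N, q t s a)
        + (∑ t ∈ Finset.range N, noisyValue π (q t) s + N * M.reg s (π s))) := by
  unfold offlineGap conjugateReg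
  rw [ciSup_add (M.bddAbove_conjugateReg N s _)]
  simp_rw [neg_sum_noisyAdvantage]

lemma neg_sum_noisyAdvantage_le_offlineGap [Nonempty A] (M : RegMDP S A) (π : Policy S A) (N : ℕ)
    (q : ℕ → S → A → ℝ) (s : S) (p : stdSimplex ℝ A) :
    (N : ℝ)⁻¹ * -∑ t ∈ Finset.range N, M.noisyAdvantage π (q t) s p ≤ M.offlineGap π N q s := by
  rw [offlineGap_eq, neg_sum_noisyAdvantage]
  gcongr
  exact le_ciSup (M.bddAbove_conjugateReg N s _) p

lemma measurable_offlineEstimate [Nonempty A] {Ω : Type uO} [MeasurableSpace Ω] (M : RegMDP S A)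
    (π : Policy S A) (N : ℕ) {q : Ω → ℕ → S → A → ℝ}
    (hq : ∀ t s a, Measurable fun w => q w t s a) (s : S) :
    Measurable fun w => M.offlineEstimate π N (q w) s := by
  have hv : ∀ s, Measurable fun w => ∑ t ∈ Finset.range N, noisyValue π (q w t) s := fun s =>
    Finset.measurable_fun_sum _ fun t _ => Finset.measurable_fun_sum _ fun a _ =>
      (hq t s a).mul_const _
  have hg : ∀ s, Measurable fun w => M.offlineGap π N (q w) s := fun s => by
    simp_rw [offlineGap_eq]
    refine (Measurable.add ?_ ((hv s).add_const _)).const_mul _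
    exact (M.lipschitzWith_conjugateReg N s).continuous.measurable.comp
      (measurable_pi_iff.2 fun a => Finset.measurable_fun_sum _ fun t _ => hq t s a)
  exact ((hv s).const_mul _).sub ((Measurable.iSup hg).const_mul _)

/-- The sum over the estimates of the pairing of the error at a state with a direction. -/
def errorSum (Q : S → A → ℝ) (N : ℕ) (q : ℕ → S → A → ℝ) (s : S) (p : A → ℝ) : ℝ :=
  ∑ t ∈ Finset.range N, ∑ a, (q t s a - Q s a) * p a

/-- Half the difference of two policies at a state. -/
def halfDiff {S : Type uS} {A : Type uA} [Fintype A] (π π' : Policy S A) (s : S) : A → ℝ := fun a => (π' s a - π s a) / 2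

/-- The factor one half puts the direction in the unit ball, so both error sums share the constants
`ς` and `σ`; the factor `2` reappears in front of the sum. -/
lemma seminorm_halfDiff_le {S : Type uS} {A : Type uA} [Fintype A] {ν : Seminorm ℝ (A → ℝ)} (hν : ∀ p ∈ stdSimplex ℝ A, ν p ≤ 1)
    (π π' : Policy S A) (s : S) : ν (halfDiff π π' s) ≤ 1 := by
  have h1 : halfDiff π π' s = (2 : ℝ)⁻¹ • ((π' s : A → ℝ) - (π s : A → ℝ)) := by
    ext a; simp only [halfDiff, Pi.smul_apply, Pi.sub_apply, smul_eq_mul]; ring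
  have h2 := map_sub_le_add ν (π' s : A → ℝ) (π s : A → ℝ)
  have h3 := hν _ (π' s).2
  have h4 := hν _ (π s).2
  rw [h1, map_smul_eq_mul, norm_inv, Real.norm_ofNat]
  change ν (π' s : A → ℝ) ≤ 1 at h3
  change ν (π s : A → ℝ) ≤ 1 at h4
  linarith

variable [MeasurableSpace S] [MeasurableSingletonClass S]
  [MeasurableSpace A] [MeasurableSingletonClass A]

/-- The excess of the offline estimate over the value of any policy is controlled by the estimation
errors in two fixed directions. -/
lemma exists_offlineEstimate_sub_le [Nonempty A] (M : RegMDP S A) (π π' : Policy S A) {N : ℕ} (hN : 0 < N)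
    (q : ℕ → S → A → ℝ) (s : S) :
    ∃ s', M.offlineEstimate π N q s - M.V π' s
      ≤ (N : ℝ)⁻¹ * errorSum (M.Q π) N q s (π s)
        + (1 - M.γ)⁻¹ * ((N : ℝ)⁻¹ * (2 * errorSum (M.Q π) N q s' (halfDiff π π' s'))) := by
  have hne : Nonempty S := ⟨s⟩
  have hN' : (N : ℝ) ≠ 0 := Nat.cast_ne_zero.2 hN.ne'
  obtain ⟨s', hs'⟩ := Finite.exists_max fun s' =>
    (N : ℝ)⁻¹ * (2 * errorSum (M.Q π) N q s' (halfDiff π π' s'))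
  refine ⟨s', ?_⟩
  have hvalue : offlineValue π N q s
      = M.V π s + (N : ℝ)⁻¹ * errorSum (M.Q π) N q s (π s) := by
    have h1 : M.V π s = ∑ a, M.Q π s a * π s a := by
      rw [M.V_eq_sum_Q]; exact Finset.sum_congr rfl fun a _ => mul_comm _ _
    simp only [offlineValue, errorSum, noisyValue, sub_mul, Finset.sum_sub_distrib,
      Finset.sum_const, Finset.card_range, nsmul_eq_mul, ← h1]
    field_simp
    ring
  have hgap : ∀ z, ∑ a, M.Q π z a * (π z a - π' z a) + M.reg z (π z) - M.reg z (π' z)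
      ≤ (⨆ z, M.offlineGap π N q z)
        + (N : ℝ)⁻¹ * (2 * errorSum (M.Q π) N q s' (halfDiff π π' s')) := by
    intro z
    have h1 := M.neg_sum_noisyAdvantage_le_offlineGap π N q z (π' z)
    have h2 : M.offlineGap π N q z ≤ ⨆ z, M.offlineGap π N q z :=
      le_ciSup (Set.finite_range _).bddAbove z
    have h3 := hs' z
    -- The regularizer terms of the true and empirical advantages coincide, leaving only the error
    -- paired with `π' - π`.
    have h4 : ∑ a, M.Q π z a * (π z a - π' z a) + M.reg z (π z) - M.reg z (π' z)
        = (N : ℝ)⁻¹ * -∑ t ∈ Finset.range N, M.noisyAdvantage π (q t) z (π' z)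
          + (N : ℝ)⁻¹ * (2 * errorSum (M.Q π) N q z (halfDiff π π' z)) := by
      have h5 : 2 * errorSum (M.Q π) N q z (halfDiff π π' z)
          = ∑ t ∈ Finset.range N, (∑ a, q t z a * π' z a - noisyValue π (q t) z
            + ∑ a, M.Q π z a * (π z a - π' z a)) := by
        unfold errorSum halfDiff noisyValue
        rw [Finset.mul_sum]
        refine Finset.sum_congr rfl fun t _ => ?_
        rw [Finset.mul_sum, ← Finset.sum_sub_distrib, ← Finset.sum_add_distrib]
        exact Finset.sum_congr rfl fun a _ => by ring
      rw [h5]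
      simp only [noisyAdvantage, Finset.sum_sub_distrib, Finset.sum_add_distrib,
        Finset.sum_const, Finset.card_range, nsmul_eq_mul]
      field_simp
      ring
    linarith
  have hV := M.V_sub_le π π' hgap s
  rw [offlineEstimate, hvalue]
  linarith

end RegMDP

end Estimates

/-! ### The bounds in expectation and in high probability. -/

section Bounds

variable {S : Type uS} {A : Type uA} [Fintype S] [Nonempty S] [Fintype A] [Nonempty A]
  [MeasurableSpace S] [MeasurableSingletonClass S]
  [MeasurableSpace A] [MeasurableSingletonClass A]
  {M : RegMDP S A} {π π' : Policy S A} {ν : Seminorm ℝ (A → ℝ)}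
  {Ω : Type uO} [MeasurableSpace Ω] {μ : Measure Ω} [IsProbabilityMeasure μ]
  {X : Type uX} [MeasurableSpace X] {ξ : ℕ → Ω → X} {est : ℕ → X → S → A → ℝ}
  {N : ℕ} {ς σ Qbar : ℝ}

omit [Nonempty S] in
/-- The two error processes that control the offline estimate. -/
lemma LightTailAssumption.isLightTailedSeq_errors (hν : ∀ x, ν x = 0 → x = 0)
    (hξ : ∀ t, Measurable (ξ t)) (hest : ∀ t s a, Measurable (fun x => est t x s a))
    (h : LightTailAssumption μ (pastSigma ξ) N ν (M.Q π) (fun t w => est t (ξ t w)) ς σ Qbar)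
    (s : S) :
    IsLightTailedSeq μ (pastSigma ξ) N
        (fun t w => ∑ a, (est t (ξ t w) s a - M.Q π s a) * π s a) ς σ ∧
      IsLightTailedSeq μ (pastSigma ξ) N
        (fun t w => ∑ a, (est t (ξ t w) s a - M.Q π s a) * RegMDP.halfDiff π π' s a) ς σ :=
  ⟨h.isLightTailedSeq hξ hest hν s (h.norm_le_one _ (π s).2),
    h.isLightTailedSeq hξ hest hν s (RegMDP.seminorm_halfDiff_le h.norm_le_one π π' s)⟩

/-- The offline estimate exceeds the value of any policy by at most `O(σ log |S|)` over
`(1 - γ) √N` in expectation. -/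
lemma LightTailAssumption.integral_posPart_offlineEstimate_sub_le (hν : ∀ x, ν x = 0 → x = 0)
    (hξ : ∀ t, Measurable (ξ t)) (hest : ∀ t s a, Measurable (fun x => est t x s a))
    (hN : 0 < N) (hς : 0 ≤ ς) (hσ : 0 ≤ σ) (hbias : N * ς ≤ σ)
    (h : LightTailAssumption μ (pastSigma ξ) N ν (M.Q π) (fun t w => est t (ξ t w)) ς σ Qbar)
    (s : S) :
    Integrable (fun w => max 0
      (M.offlineEstimate π N (fun t => est t (ξ t w)) s - M.V π' s)) μ ∧
    ∫ w, max 0 (M.offlineEstimate π N (fun t => est t (ξ t w)) s - M.V π' s) ∂μ ≤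
      24 * σ * (Real.log (Fintype.card S) + 1) / ((1 - M.γ) * √N) := by
  have hP := h.isLightTailedSeq_errors (π' := π') hν hξ hest
  have hN' : (0 : ℝ) < N := Nat.cast_pos.2 hN
  have hγ : 0 < 1 - M.γ := sub_pos.2 M.γ_lt_one
  have hG : 1 ≤ (1 - M.γ)⁻¹ := (one_le_inv₀ hγ).2 (by linarith [M.γ_nonneg])
  set G := (1 - M.γ)⁻¹ with hGdef
  have hS : (1 : ℝ) ≤ Fintype.card S := by exact_mod_cast Fintype.card_pos
  set K := Real.log (Fintype.card S) with hK
  have hK0 : 0 ≤ K := Real.log_nonneg hS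
  set W : Ω → ℝ := fun w =>
    max 0 (M.offlineEstimate π N (fun t => est t (ξ t w)) s - M.V π' s) with hW
  have hWm : Measurable W := measurable_const.max
    ((M.measurable_offlineEstimate π N (fun t s a => (hest t s a).comp (hξ t)) s).sub_const _)
  have hex := fun w => M.exists_offlineEstimate_sub_le π π' hN (fun t => est t (ξ t w)) s
  rcases hσ.eq_or_lt with hσ0 | hσ0
  · have hW0 : W =ᵐ[μ] fun _ => 0 := by
      filter_upwards [(hP s).1.ae_sum_eq_zero hσ0.symm,
        ae_all_iff.2 fun s' => (hP s').2.ae_sum_eq_zero hσ0.symm] with w h1 h2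
      obtain ⟨s', hs'⟩ := hex w
      have h3 : RegMDP.errorSum (M.Q π) N (fun t => est t (ξ t w)) s (π s) = 0 := h1
      have h4 : RegMDP.errorSum (M.Q π) N (fun t => est t (ξ t w)) s'
        (RegMDP.halfDiff π π' s') = 0 := h2 s'
      rw [h3, h4] at hs'
      exact max_eq_left (hs'.trans (by simp))
    refine ⟨(integrable_const (0 : ℝ)).congr hW0.symm, ?_⟩
    rw [integral_congr_ae hW0, ← hσ0]
    simp
  set r := σ * √N with hr
  have hr0 : 0 < r := mul_pos hσ0 (Real.sqrt_pos.2 hN')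
  set x : Ω → ℝ := fun w =>
    Real.exp (r⁻¹ * RegMDP.errorSum (M.Q π) N (fun t => est t (ξ t w)) s (π s)) with hx
  set z : S → Ω → ℝ := fun s' w =>
    Real.exp (r⁻¹ * RegMDP.errorSum (M.Q π) N (fun t => est t (ξ t w)) s'
      (RegMDP.halfDiff π π' s')) with hz
  obtain ⟨hxi, hxle⟩ : Integrable x μ ∧ ∫ w, x w ∂μ ≤ 37 / 5 :=
    (hP s).1.integral_exp_normalized_sum_le hN hσ0 hς hbias
  have hzi : ∀ s', Integrable (z s') μ ∧ ∫ w, z s' w ∂μ ≤ 37 / 5 := fun s' =>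
    (hP s').2.integral_exp_normalized_sum_le hN hσ0 hς hbias
  have hzsi : Integrable (fun w => ∑ s', z s' w) μ := integrable_finsetSum _ fun s' _ => (hzi s').1
  set c : ℝ := (Fintype.card S : ℝ) with hc
  have hzK : Integrable (fun w => K + c⁻¹ * ∑ s', z s' w) μ :=
    (integrable_const K).add (hzsi.const_mul c⁻¹)
  -- An integrable majorant that does not depend on the random state `s'`. It uses `u ≤ exp u` at `u
  -- = y / r` and at `u = y / r - log |S|`; the shift turns the sum over states into an average and
  -- costs `log |S|`.
  set U : Ω → ℝ := fun w => (N : ℝ)⁻¹ * r * (x w + G * (2 * (K + c⁻¹ * ∑ s', z s' w))) with hU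
  have hUi : Integrable U μ :=
    (hxi.add ((hzK.const_mul 2).const_mul G)).const_mul _
  have hx0 : ∀ w, 0 ≤ x w := fun w => (Real.exp_pos _).le
  have hz0 : ∀ s' w, 0 ≤ z s' w := fun s' w => (Real.exp_pos _).le
  have hWU : ∀ w, W w ≤ U w := fun w => by
    have hsum0 : 0 ≤ ∑ s', z s' w := Finset.sum_nonneg fun s' _ => hz0 s' w
    refine max_le (by have := hx0 w; positivity) ?_
    obtain ⟨s', hs'⟩ := hex w
    refine hs'.trans ?_
    have h1 : RegMDP.errorSum (M.Q π) N (fun t => est t (ξ t w)) s (π s) ≤ r * x w := by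
      have := Real.add_one_le_exp
        (r⁻¹ * RegMDP.errorSum (M.Q π) N (fun t => est t (ξ t w)) s (π s))
      rw [← inv_mul_le_iff₀ hr0]
      linarith
    have h2 : RegMDP.errorSum (M.Q π) N (fun t => est t (ξ t w)) s' (RegMDP.halfDiff π π' s')
        ≤ r * (K + c⁻¹ * ∑ s', z s' w) := by
      set y := RegMDP.errorSum (M.Q π) N (fun t => est t (ξ t w)) s' (RegMDP.halfDiff π π' s')
      have h3 := Real.add_one_le_exp (r⁻¹ * y - K)
      rw [Real.exp_sub, hK, Real.exp_log (by linarith), div_eq_inv_mul] at h3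
      have h4 : z s' w ≤ ∑ s', z s' w :=
        Finset.single_le_sum (fun s' _ => hz0 s' w) (Finset.mem_univ s')
      have h5 : c⁻¹ * z s' w ≤ c⁻¹ * ∑ s', z s' w := by gcongr
      have h6 : z s' w = Real.exp (r⁻¹ * y) := rfl
      rw [← inv_mul_le_iff₀ hr0]
      rw [h6] at h5
      linarith
    calc _ ≤ (N : ℝ)⁻¹ * (r * x w)
          + G * ((N : ℝ)⁻¹ * (2 * (r * (K + c⁻¹ * ∑ s', z s' w)))) := by gcongr
      _ = _ := by rw [hU]; ring
  have hWi : Integrable W μ := hUi.mono' hWm.aestronglyMeasurable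
    (Filter.Eventually.of_forall fun w => by
      rw [Real.norm_eq_abs, abs_of_nonneg (le_max_left _ _)]; exact hWU w)
  refine ⟨hWi, (integral_mono hWi hUi hWU).trans ?_⟩
  have hzs : c⁻¹ * ∫ w, ∑ s', z s' w ∂μ ≤ 37 / 5 := by
    rw [integral_finsetSum _ fun s' _ => (hzi s').1, inv_mul_le_iff₀ (by linarith)]
    calc _ ≤ ∑ _s' : S, (37 / 5 : ℝ) := Finset.sum_le_sum fun s' _ => (hzi s').2
      _ = _ := by rw [Finset.sum_const, nsmul_eq_mul, Finset.card_univ]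
  have hUint : ∫ w, U w ∂μ
      = (N : ℝ)⁻¹ * r * (∫ w, x w ∂μ + G * (2 * (K + c⁻¹ * ∫ w, ∑ s', z s' w ∂μ))) := by
    rw [hU, integral_const_mul, integral_add hxi ((hzK.const_mul 2).const_mul G), integral_const_mul,
      integral_const_mul, integral_add (integrable_const _) (hzsi.const_mul _),
      integral_const_mul]
    simp
  have hrN : (N : ℝ)⁻¹ * r = σ / √N := by
    have := Real.mul_self_sqrt hN'.le
    rw [hr, inv_mul_eq_div, div_eq_div_iff hN'.ne' (Real.sqrt_pos.2 hN').ne', mul_assoc, this]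
  rw [hUint, hrN]
  -- The total `3 * (37 / 5) + 2 K` is at most `24 (K + 1)`, which fixes the final constant.
  calc _ ≤ σ / √N * (G * (37 / 5) + G * (2 * (K + 37 / 5))) := by
        gcongr
        nlinarith
    _ ≤ σ / √N * (G * (24 * (K + 1))) := by
        rw [← mul_add]
        gcongr
        linarith
    _ = _ := by rw [hGdef]; field_simp

/-- Large deviations of the offline estimate above the value of any policy. -/
lemma LightTailAssumption.measure_offlineEstimate_sub_gt_le (hν : ∀ x, ν x = 0 → x = 0)
    (hξ : ∀ t, Measurable (ξ t)) (hest : ∀ t s a, Measurable (fun x => est t x s a))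
    (hN : 0 < N) (hς : 0 ≤ ς) (hσ : 0 ≤ σ) (hbias : N * ς ≤ σ)
    (h : LightTailAssumption μ (pastSigma ξ) N ν (M.Q π) (fun t w => est t (ξ t w)) ς σ Qbar)
    {δ : ℝ} (hδ : 0 < δ) (hδ1 : δ ≤ 1) :
    μ {w | ∃ s : S, M.offlineEstimate π N (fun t => est t (ξ t w)) s - M.V π' s >
        σ * √(3 * Real.log (4 * Fintype.card S / δ) / N)
          + 2 * σ * √(3 * Real.log (16 * Fintype.card S / δ)) / ((1 - M.γ) * √N)}
      ≤ ENNReal.ofReal δ := by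
  have hP := h.isLightTailedSeq_errors (π' := π') hν hξ hest
  have hN' : (0 : ℝ) < N := Nat.cast_pos.2 hN
  have hγ : 0 < 1 - M.γ := sub_pos.2 M.γ_lt_one
  have hS : (1 : ℝ) ≤ Fintype.card S := by exact_mod_cast Fintype.card_pos
  have hlog : ∀ k : ℝ, 4 ≤ k → Real.log 4 ≤ Real.log (k * Fintype.card S / δ) := fun k hk => by
    refine Real.log_le_log (by norm_num) ?_
    rw [le_div_iff₀ hδ]
    nlinarith
  have hexp : ∀ k : ℝ, 4 ≤ k →
      2 * Real.exp (-Real.log (k * Fintype.card S / δ)) = 2 * δ / (k * Fintype.card S) := by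
    intro k hk
    rw [Real.exp_neg, Real.exp_log (by positivity), inv_div]
    ring
  set L₁ := Real.log (4 * Fintype.card S / δ)
  set L₂ := Real.log (16 * Fintype.card S / δ)
  have hsqrt : ∀ L : ℝ, (N : ℝ)⁻¹ * √(L * N) = √L / √N := fun L => by
    have := Real.mul_self_sqrt hN'.le
    rw [Real.sqrt_mul' _ hN'.le, inv_mul_eq_div,
      div_eq_div_iff hN'.ne' (Real.sqrt_pos.2 hN').ne', mul_assoc, this]
  have hsub : {w | ∃ s : S, M.offlineEstimate π N (fun t => est t (ξ t w)) s - M.V π' s >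
        σ * √(3 * L₁ / N) + 2 * σ * √(3 * L₂) / ((1 - M.γ) * √N)}
      ⊆ ⋃ s : S, ({w | σ * √(3 * L₁ * N)
            < RegMDP.errorSum (M.Q π) N (fun t => est t (ξ t w)) s (π s)}
          ∪ {w | σ * √(3 * L₂ * N)
            < RegMDP.errorSum (M.Q π) N (fun t => est t (ξ t w)) s (RegMDP.halfDiff π π' s)}) := by
    rintro w ⟨s, hs⟩
    by_contra hcon
    simp only [Set.mem_iUnion, Set.mem_union, Set.mem_ofPred_eq, not_exists, not_or, not_lt] at hcon
    -- The state `s'` depends on the outcome, so the second error sum must be controlled at every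
    -- state.
    obtain ⟨s', hs'⟩ := M.exists_offlineEstimate_sub_le π π' hN (fun t => est t (ξ t w)) s
    have h1 := (hcon s).1
    have h2 := (hcon s').2
    have h3 : (N : ℝ)⁻¹ * (σ * √(3 * L₁ * N)) = σ * √(3 * L₁ / N) := by
      rw [mul_left_comm, hsqrt, Real.sqrt_div' _ hN'.le]
    have h4 : (1 - M.γ)⁻¹ * ((N : ℝ)⁻¹ * (2 * (σ * √(3 * L₂ * N))))
        = 2 * σ * √(3 * L₂) / ((1 - M.γ) * √N) := by
      have := hsqrt (3 * L₂)
      calc _ = (1 - M.γ)⁻¹ * (2 * σ) * ((N : ℝ)⁻¹ * √(3 * L₂ * N)) := by ring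
        _ = _ := by rw [this]; field_simp
    have h5 : (N : ℝ)⁻¹ * RegMDP.errorSum (M.Q π) N (fun t => est t (ξ t w)) s (π s)
        + (1 - M.γ)⁻¹ * ((N : ℝ)⁻¹ * (2 * RegMDP.errorSum (M.Q π) N
          (fun t => est t (ξ t w)) s' (RegMDP.halfDiff π π' s')))
        ≤ (N : ℝ)⁻¹ * (σ * √(3 * L₁ * N))
          + (1 - M.γ)⁻¹ * ((N : ℝ)⁻¹ * (2 * (σ * √(3 * L₂ * N)))) := by
      gcongr
    rw [h3, h4] at h5
    exact absurd (hs'.trans h5) (not_le.2 hs)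
  calc _ ≤ μ _ := measure_mono hsub
    _ ≤ ∑ s : S, _ := measure_iUnion_fintype_le _ _
    _ ≤ ∑ _s : S, ENNReal.ofReal (δ / Fintype.card S) := Finset.sum_le_sum fun s _ => by
        refine (measure_union_le _ _).trans ?_
        have h1 := (hP s).1.measure_sum_gt_le hN hσ hς hbias (hlog 4 le_rfl)
        have h2 := (hP s).2.measure_sum_gt_le hN hσ hς hbias (hlog 16 (by norm_num))
        rw [hexp _ (by norm_num)] at h1 h2
        refine (add_le_add h1 h2).trans ?_
        rw [← ENNReal.ofReal_add (by positivity) (by positivity)]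
        refine ENNReal.ofReal_le_ofReal ?_
        -- The two tails use up `5 / 8` of each state's share `δ / |S|`.
        have h3 : 2 * δ / (4 * Fintype.card S) + 2 * δ / (16 * Fintype.card S)
            = 5 / 8 * (δ / Fintype.card S) := by field_simp; norm_num
        rw [h3]
        have : 0 ≤ δ / Fintype.card S := by positivity
        linarith
    _ = ENNReal.ofReal δ := by
        rw [Finset.sum_const, Finset.card_univ, nsmul_eq_mul, ← ENNReal.ofReal_natCast,
          ← ENNReal.ofReal_mul (by positivity), mul_div_cancel₀ _ (by positivity)]

end Bounds

end

/-! ### Assembly of the theorem. -/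

theorem mainTheorem10 :
    ∃ C : ℝ, 0 < C ∧
      ∀ (S : Type uS) (A : Type uA) [Fintype S] [Nonempty S] [Fintype A] [Nonempty A]
        [MeasurableSpace S] [MeasurableSingletonClass S]
        [MeasurableSpace A] [MeasurableSingletonClass A]
        (M : RegMDP S A) (πopt πhat : Policy S A) (_ : M.IsOptimal πopt)
        -- the norm, the distance generating function, and the bound on Bregman's distance
        (ν : Seminorm ℝ (A → ℝ)) (_ : ∀ x, ν x = 0 → x = 0)
        (ω : (A → ℝ) → ℝ) (_ : IsDistanceGenerating ν ω)
        (π₀ : Policy S A)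
        (_ : ∀ s, DifferentiableWithinAt ℝ ω (stdSimplex ℝ A) (π₀ s))
        (D₀ : ℝ) (_ : 0 < D₀) (_ : ∀ s, ∀ p ∈ stdSimplex ℝ A, bregman ω (π₀ s) p ≤ D₀)
        -- the samples and the estimates that are formed from them
        (Ω : Type uO) [MeasurableSpace Ω] (μ : Measure Ω) [IsProbabilityMeasure μ]
        (X : Type uX) [MeasurableSpace X] (ξ : ℕ → Ω → X) (_ : ∀ t, Measurable (ξ t))
        (est : ℕ → X → S → A → ℝ) (_ : ∀ t s a, Measurable (fun x => est t x s a))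
        (N : ℕ) (_ : 0 < N)
        (ς σ Qbar : ℝ) (_ : 0 ≤ ς) (_ : 0 ≤ σ) (_ : 0 ≤ Qbar),
        -- the bound in expectation
        (MomentAssumption μ (pastSigma ξ) N ν (M.Q πhat) (fun t w => est t (ξ t w)) ς σ Qbar →
          LightTailAssumption μ (pastSigma ξ) N ν (M.Q πhat) (fun t w => est t (ξ t w)) ς σ Qbar →
          ς ≤ σ / (2 * N) →
          ∀ s : S,
            Integrable (fun w => max 0
              (M.offlineEstimate πhat N (fun t => est t (ξ t w)) s - M.V πopt s)) μ ∧
            ∫ w, max 0 (M.offlineEstimate πhat N (fun t => est t (ξ t w)) s - M.V πopt s) ∂μ ≤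
              √((σ ^ 2 + N * ς ^ 2) / N)
              + 2 * √(σ ^ 2 * D₀) / ((1 - M.γ) * √N)
              + (8 * C * σ * (Real.log (Fintype.card S) + 1) + 4 * √(σ ^ 2 + N * ς ^ 2))
                / ((1 - M.γ) * √N)) ∧
        -- the bound in high probability
        (LightTailAssumption μ (pastSigma ξ) N ν (M.Q πhat) (fun t w => est t (ξ t w)) ς σ Qbar →
          ς ≤ σ / N →
          ∀ δ : ℝ, 0 < δ → δ ≤ 1 →
            μ {w | ∃ s : S,
                M.offlineEstimate πhat N (fun t => est t (ξ t w)) s - M.V πopt s >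
                  σ * √(3 * Real.log (4 * Fintype.card S / δ) / N)
                  + (4 * √(σ ^ 2 * D₀)
                      + 4 * σ * √(3 * Real.log (16 * Fintype.card S / δ))
                      + 24 * √(σ ^ 2 * D₀) * Real.log (32 * Fintype.card S / δ))
                    / ((1 - M.γ) * √N)}
              ≤ ENNReal.ofReal δ) := by
  -- With `C = 3` the coefficient `8 C` is the `24` of the bound in expectation. The remaining terms
  -- on both right-hand sides are nonnegative slack.
  refine ⟨3, by norm_num, ?_⟩
  intro S A _ _ _ _ _ _ _ _ M πopt πhat _ ν hν ω _ π₀ _ D₀ hD₀ _ Ω _ μ _ X _ ξ hξ est hest N hN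
    ς σ Qbar hς hσ _
  have hN' : (0 : ℝ) < N := Nat.cast_pos.2 hN
  have hγ : 0 < 1 - M.γ := sub_pos.2 M.γ_lt_one
  have hS : (1 : ℝ) ≤ Fintype.card S := by exact_mod_cast Fintype.card_pos
  refine ⟨fun _ h hb s => ?_, fun h hb δ hδ hδ1 => ?_⟩
  · have hbias : N * ς ≤ σ := by
      rw [le_div_iff₀ (by positivity)] at hb
      nlinarith
    obtain ⟨h1, h2⟩ := h.integral_posPart_offlineEstimate_sub_le (π' := πopt) hν hξ hest hN hς hσ
      hbias s
    refine ⟨h1, h2.trans ?_⟩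
    have h3 : 24 * σ * (Real.log (Fintype.card S) + 1) / ((1 - M.γ) * √N)
        ≤ (8 * 3 * σ * (Real.log (Fintype.card S) + 1) + 4 * √(σ ^ 2 + N * ς ^ 2))
          / ((1 - M.γ) * √N) := by
      gcongr
      have := Real.sqrt_nonneg (σ ^ 2 + N * ς ^ 2)
      linarith
    have h4 : 0 ≤ √((σ ^ 2 + N * ς ^ 2) / N) + 2 * √(σ ^ 2 * D₀) / ((1 - M.γ) * √N) := by
      positivity
    linarith
  · have hbias : N * ς ≤ σ := by
      rwa [le_div_iff₀ hN', mul_comm] at hb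
    refine (measure_mono fun w hw => ?_).trans
      (h.measure_offlineEstimate_sub_gt_le (π' := πopt) hν hξ hest hN hς hσ hbias hδ hδ1)
    obtain ⟨s, hs⟩ := hw
    refine ⟨s, lt_of_le_of_lt ?_ hs⟩
    have hlog : 0 ≤ Real.log (32 * Fintype.card S / δ) := by
      refine Real.log_nonneg ?_
      rw [le_div_iff₀ hδ]
      linarith
    gcongr
    have h1 : 0 ≤ 4 * √(σ ^ 2 * D₀) := by positivity
    have h2 : 0 ≤ 24 * √(σ ^ 2 * D₀) * Real.log (32 * Fintype.card S / δ) := by positivity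
    have h3 : 0 ≤ σ * √(3 * Real.log (16 * Fintype.card S / δ)) := by positivity
    linarith
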